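/- Let $\mathbb K$ be a field. Let $\mathbf{Op}$ be the category of finitely generated binary quadratic symmetric operads in $\mathbb K$-vector spaces, that is, the full subcategory of symmetric operads formed by those isomorphic to $\mathcal F(E)/(R)$ with $E$ a finite-dimensional $S_2$-module of binary generating operations and $R$ a set of relations in $\mathcal F(E)(3)$. Let $\mathcal Perm\in\mathbf{Op}$ be the operad of right permutative algebras, generated by one non-symmetric product $\mu(x,y)=xy$ with the relations $(xy)z=x(yz)=x(zy)$. Let $\mathcal Perm\circ-:\mathbf{Op}\to\mathbf{Op}$ be the Manin white product with $\mathcal Perm$: the operad $\mathcal Perm\circ\mathcal O$ is the quadratic operad generated by $\mathcal Perm(2)\otimes\mathcal O(2)$ whose relations are the kernel of the natural map $\mathcal F(\mathcal Perm(2)\otimes\mathcal O(2))(3)\to\mathcal Perm(3)\otimes\mathcal O(3)$. Let $C^*(\Delta_1,v_l;V)$ be the complex of non-degenerate cochains on the $1$-simplex, with coefficients in a vector space $V$, that vanish on the left vertex $v_l$. For an $\mathcal O$-algebra $V$ and $o\in\mathcal O(2)$ let $\cup\otimes o$ be the cup product on $C^*(\Delta_1,v_l;V)=C^*(\Delta_1,v_l;\mathbb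 K)\otimes V$ in which the coefficients are multiplied by $o$. These products make $C^*(\Delta_1,v_l;V)$ a complex with operations that satisfy the Leibniz rule and for which the cochains vanishing on $\partial\Delta_1$ form a dg ideal. Let $\operatorname{Perm}_\circ(\mathcal O)\in\mathbf{Op}$ be the quadratic operad generated by non-symmetric operations $\cup\otimes o$, linear in $o\in\mathcal O(2)$, together with all the quadratic relations among these operations and their opposites that hold, with the Koszul sign rule, in $C^*(\Delta_1,v_l;V)$ for every $\mathcal O$-algebra $V$. (If $\mathcal O$ is generated by non-symmetric products $\cdot_i$, commutative products $\bullet_j$ and anti-commutative brackets $[-,-]_k$, then the generators are $\prec_i=\cup\otimes\cdot_i$, $\succ_i=\cup\otimes\cdot_i^{op}$, $\circ_j=\cup\otimes\bullet_j$, $\ast_k=\cup\otimes[-,-]_k$.) This defines a functor $\operatorname{Perm}_\circ(-):\mathbf{Op}\to\mathbf{Op}$. Theorem. There is a natural isomorphism $\operatorname{Perm}_\circ(-)\xrightarrow{\cong}\mathcal Perm\circ-$ of functors $\mathbf{Op}\to\mathbf{Op}$, which for every $\mathcal O\in\mathbf{Op}$ and $o\in\mathcal O(2)$ sends the generating operation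 $\cup\otimes o$ of $\operatorname{Perm}_\circ(\mathcal O)$ to the generating operation $\mu\otimes o$ of $\mathcal Perm\circ\mathcal O$. -/

import Mathlib

open CategoryTheory TensorProduct

universe u

noncomputable section

namespace ManinProduct

/-! ## Symmetric operads in vector spaces

A symmetric operad is presented in its coordinate-free form: a functor `ι ↦ P(ι)` on finite sets
and bijections (with `P(n) = P(Fin n)` carrying the action of the symmetric group), a unit in
`P(∗)` and compositions `P(ι) ⊗ ⨂ᵢ P(κᵢ) → P(Σᵢ κᵢ)`, natural, associative and unital. -/

/-- A symmetric operad in vector spaces over `K`. An element `p` of `obj ι` is thought of as a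
multilinear operation `(xᵢ)_{i ∈ ι} ↦ p(x)`; `relabel e p` is `y ↦ p(y ∘ e)`. -/
structure SymOperad (K : Type u) [Field K] where
  obj : (ι : Type) → [Finite ι] → Type u
  [grp : ∀ (ι : Type) [Finite ι], AddCommGroup (obj ι)]
  [mod : ∀ (ι : Type) [Finite ι], Module K (obj ι)]
  relabel : ∀ {ι κ : Type} [Finite ι] [Finite κ], (ι ≃ κ) → (obj ι →ₗ[K] obj κ)
  one : obj Unit
  comp : ∀ {ι : Type} [Finite ι] {κ : ι → Type} [∀ i, Finite (κ i)],
    obj ι →ₗ[K] MultilinearMap K (fun i => obj (κ i)) (obj (Σ i, κ i))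
  relabel_refl : ∀ {ι : Type} [Finite ι] (p : obj ι), relabel (Equiv.refl ι) p = p
  relabel_trans : ∀ {ι κ l : Type} [Finite ι] [Finite κ] [Finite l] (e : ι ≃ κ) (f : κ ≃ l)
    (p : obj ι), relabel (e.trans f) p = relabel f (relabel e p)
  comp_relabel_left : ∀ {ι ι' : Type} [Finite ι] [Finite ι'] {κ : ι' → Type}
    [∀ j, Finite (κ j)] (e : ι ≃ ι') (p : obj ι) (q : ∀ j, obj (κ j)),
    comp (relabel e p) q = relabel (Equiv.sigmaCongrLeft e) (comp p (fun i => q (e i)))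
  comp_relabel_right : ∀ {ι : Type} [Finite ι] {κ l : ι → Type} [∀ i, Finite (κ i)]
    [∀ i, Finite (l i)] (f : ∀ i, κ i ≃ l i) (p : obj ι) (q : ∀ i, obj (κ i)),
    comp p (fun i => relabel (f i) (q i)) = relabel (Equiv.sigmaCongrRight f) (comp p q)
  one_comp : ∀ {κ : Type} [Finite κ] (q : obj κ),
    comp one (fun _ => q) = relabel (Equiv.uniqueSigma (fun _ : Unit => κ)).symm q
  comp_one : ∀ {ι : Type} [Finite ι] (p : obj ι),
    comp p (fun _ => one) = relabel (Equiv.sigmaPUnit ι).symm p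
  comp_assoc : ∀ {ι : Type} [Finite ι] {κ : ι → Type} [∀ i, Finite (κ i)]
    {l : ∀ i, κ i → Type} [∀ i j, Finite (l i j)]
    (p : obj ι) (q : ∀ i, obj (κ i)) (r : ∀ i j, obj (l i j)),
    comp (κ := fun x : Σ i, κ i => l x.1 x.2) (comp p q) (fun x => r x.1 x.2) =
      relabel (Equiv.sigmaAssoc l).symm (comp p (fun i => comp (q i) (r i)))

attribute [instance] SymOperad.grp SymOperad.mod

namespace SymOperad

variable {K : Type u} [Field K]

/-- A morphism of operads. -/
@[ext]
structure Hom (P Q : SymOperad K) where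
  app : ∀ (ι : Type) [Finite ι], P.obj ι →ₗ[K] Q.obj ι
  app_relabel : ∀ {ι κ : Type} [Finite ι] [Finite κ] (e : ι ≃ κ) (p : P.obj ι),
    app κ (P.relabel e p) = Q.relabel e (app ι p)
  app_one : app Unit P.one = Q.one
  app_comp : ∀ {ι : Type} [Finite ι] {κ : ι → Type} [∀ i, Finite (κ i)]
    (p : P.obj ι) (q : ∀ i, P.obj (κ i)),
    app (Σ i, κ i) (P.comp p q) = Q.comp (app ι p) (fun i => app (κ i) (q i))

instance : Category (SymOperad K) where
  Hom := Hom
  id P := ⟨fun _ _ => LinearMap.id, fun _ _ => rfl, rfl, fun _ _ => rfl⟩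
  comp f g := ⟨fun ι _ => (g.app ι).comp (f.app ι),
    fun e p => by simp [f.app_relabel, g.app_relabel],
    by simp [f.app_one, g.app_one],
    fun p q => by simp [f.app_comp, g.app_comp]⟩

lemma id_app (P : SymOperad K) (ι : Type) [Finite ι] (p : P.obj ι) :
    Hom.app (𝟙 P) ι p = p := rfl

lemma comp_app {P Q R : SymOperad K} (f : P ⟶ Q) (g : Q ⟶ R) (ι : Type) [Finite ι]
    (p : P.obj ι) : Hom.app (f ≫ g) ι p = Hom.app g ι (Hom.app f ι p) := rfl

lemma hom_ext {P Q : SymOperad K} {f g : P ⟶ Q}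
    (h : ∀ (ι : Type) [Finite ι] (p : P.obj ι), Hom.app f ι p = Hom.app g ι p) : f = g :=
  Hom.ext (funext fun ι => funext fun _ => LinearMap.ext fun p => h ι p)

/-- The opposite of a binary operation: `(swap p)(x, y) = p(y, x)`. -/
def swap (P : SymOperad K) : P.obj (Fin 2) →ₗ[K] P.obj (Fin 2) :=
  P.relabel (Equiv.swap 0 1)

lemma swap_swap (P : SymOperad K) (p : P.obj (Fin 2)) : P.swap (P.swap p) = p := by
  unfold swap
  rw [← P.relabel_trans]
  convert P.relabel_refl p using 2
  ext x
  simp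

/-- The arities used in forming the ternary operation `e(f(x₀, x₁), x₂)`. -/
@[reducible]
def combArity : Fin 2 → Type
  | 0 => Fin 2
  | 1 => Unit

instance : ∀ i, Finite (combArity i)
  | 0 => inferInstanceAs (Finite (Fin 2))
  | 1 => inferInstanceAs (Finite Unit)

/-- The arguments `(f, 1)` plugged in a binary operation. -/
def combArg (P : SymOperad K) (f : P.obj (Fin 2)) : ∀ i, P.obj (combArity i)
  | 0 => f
  | 1 => P.one

/-- The bijection `(0,0) ↦ 0`, `(0,1) ↦ 1`, `(1,*) ↦ 2`. -/
def combEquiv : (Σ i, combArity i) ≃ Fin 3 where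
  toFun
    | ⟨0, j⟩ => Fin.castSucc (n := 2) j
    | ⟨1, _⟩ => 2
  invFun
    | 0 => ⟨0, (0 : Fin 2)⟩
    | 1 => ⟨0, (1 : Fin 2)⟩
    | 2 => ⟨1, ()⟩
  left_inv := by
    rintro ⟨i, j⟩
    match i, j with
    | 0, j => 
      change Fin 2 at j
      fin_cases j <;> rfl
    | 1, _ => rfl
  right_inv := by
    intro i
    fin_cases i <;> rfl

lemma combArg_eq (P : SymOperad K) (f : P.obj (Fin 2)) :
    P.combArg f = Function.update (P.combArg 0) 0 f := by
  funext i
  match i with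
  | 0 => exact (Function.update_self (f := P.combArg 0) (0 : Fin 2) f).symm
  | 1 =>
    exact (Function.update_of_ne (show (1 : Fin 2) ≠ 0 by decide) (β := fun i => P.obj (combArity i))
      f (P.combArg 0)).symm

/-- The ternary operation `leftComb e f = e(f(x₀, x₁), x₂)`, bilinear in `e` and `f`. -/
def leftComb (P : SymOperad K) :
    P.obj (Fin 2) →ₗ[K] P.obj (Fin 2) →ₗ[K] P.obj (Fin 3) :=
  LinearMap.mk₂ K (fun e f => P.relabel combEquiv (P.comp e (P.combArg f)))
    (fun e e' f => by simp)
    (fun c e f => by simp)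
    (fun e f f' => by
      rw [combArg_eq P (f + f'), combArg_eq P f, combArg_eq P f']
      exact (congrArg _ ((P.comp e).map_update_add _ _ _ _)).trans (map_add _ _ _))
    (fun c e f => by
      rw [combArg_eq P (c • f), combArg_eq P f]
      exact (congrArg _ ((P.comp e).map_update_smul _ _ _ _)).trans (map_smul _ _ _))

lemma Hom.app_leftComb {P Q : SymOperad K} (φ : Hom P Q) (e f : P.obj (Fin 2)) :
    φ.app (Fin 3) (P.leftComb e f) =
      Q.leftComb (φ.app (Fin 2) e) (φ.app (Fin 2) f) := by
  simp only [leftComb, LinearMap.mk₂_apply]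
  rw [φ.app_relabel, φ.app_comp]
  congr 2
  funext i
  match i with
  | 0 => rfl
  | 1 => exact φ.app_one

/-- An algebra over the operad `P`: a vector space `V` on which every `p ∈ P(ι)` acts as a
multilinear operation, compatibly with relabelling, unit and composition. -/
structure Alg (P : SymOperad K) where
  V : Type u
  [grp : AddCommGroup V]
  [mod : Module K V]
  act : ∀ {ι : Type} [Finite ι], P.obj ι →ₗ[K] MultilinearMap K (fun _ : ι => V) V
  act_relabel : ∀ {ι κ : Type} [Finite ι] [Finite κ] (e : ι ≃ κ) (p : P.obj ι) (v : κ → V),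
    act (P.relabel e p) v = act p (v ∘ e)
  act_one : ∀ v : Unit → V, act P.one v = v ()
  act_comp : ∀ {ι : Type} [Finite ι] {κ : ι → Type} [∀ i, Finite (κ i)]
    (p : P.obj ι) (q : ∀ i, P.obj (κ i)) (v : (Σ i, κ i) → V),
    act (P.comp p q) v = act p (fun i => act (q i) (fun j => v ⟨i, j⟩))

attribute [instance] Alg.grp Alg.mod

/-- Restriction of algebras along a morphism of operads. -/
def Alg.restrict {P Q : SymOperad K} (φ : Hom P Q) (A : Q.Alg) : P.Alg where
  V := A.V
  act := A.act ∘ₗ φ.app _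
  act_relabel e p v := by simp [φ.app_relabel, A.act_relabel]
  act_one v := by simp [φ.app_one, A.act_one]
  act_comp p q v := by simp [φ.app_comp, A.act_comp]

lemma Alg.act_update_zero {P : SymOperad K} (A : P.Alg) (p : P.obj (Fin 2)) (x y z : A.V) :
    A.act p (Function.update ![x, y] 0 z) = A.act p ![z, y] := by
  congr 1
  funext i
  fin_cases i <;> simp

lemma Alg.act_update_one {P : SymOperad K} (A : P.Alg) (p : P.obj (Fin 2)) (x y z : A.V) :
    A.act p (Function.update ![x, y] 1 z) = A.act p ![x, z] := by
  congr 1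
  funext i
  fin_cases i <;> simp

/-- The bilinear product on a `P`-algebra defined by a binary operation. -/
def Alg.prod {P : SymOperad K} (A : P.Alg) : P.obj (Fin 2) →ₗ[K] A.V →ₗ[K] A.V →ₗ[K] A.V :=
  LinearMap.mk₂ K
    (fun p x => LinearMap.mk ⟨fun y => A.act p ![x, y],
      fun y y' => by
        have := (A.act p).map_update_add ![x, 0] 1 y y'
        rwa [A.act_update_one, A.act_update_one, A.act_update_one] at this⟩
      (fun c y => by
        have := (A.act p).map_update_smul ![x, 0] 1 c y
        rwa [A.act_update_one, A.act_update_one] at this))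
    (fun p p' x => by ext y; simp)
    (fun c p x => by ext y; simp)
    (fun p x x' => by
      ext y
      have := (A.act p).map_update_add ![0, y] 0 x x'
      rwa [A.act_update_zero, A.act_update_zero, A.act_update_zero] at this)
    (fun c p x => by
      ext y
      have := (A.act p).map_update_smul ![0, y] 0 c x
      rwa [A.act_update_zero, A.act_update_zero] at this)

lemma Alg.prod_apply {P : SymOperad K} (A : P.Alg) (p : P.obj (Fin 2)) (x y : A.V) :
    A.prod p x y = A.act p ![x, y] := rfl

end SymOperad

/-! ## Binary quadratic operads -/

/-- Binary quadratic data: a space `E` of binary generating operations with the involution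
`e ↦ e^op` (equivalently, a representation of `S₂`) and a set of quadratic relators. The relator
`∑ c • (e, f, σ)` stands for the element `∑ c e(f(x_{σ 0}, x_{σ 1}), x_{σ 2})` of the arity three
part of the free operad on `E` (every element of it is of this form, as
`e(x, f(y, z)) = e^op(f(y, z), x)`). -/
structure QuadData (K : Type u) [Field K] where
  E : Type u
  [grp : AddCommGroup E]
  [mod : Module K E]
  swap : E →ₗ[K] E
  swap_swap : ∀ e, swap (swap e) = e
  rel : Set (E × E × Equiv.Perm (Fin 3) →₀ K)

attribute [instance] QuadData.grp QuadData.mod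

/-- The value of a relator on `v 0, v 1, v 2` in a space with operations indexed by `E`. -/
def quadEval {K : Type u} [Field K] {E B : Type u} [AddCommGroup B] [Module K B]
    (m : E → B → B → B) (v : Fin 3 → B) : (E × E × Equiv.Perm (Fin 3) →₀ K) →ₗ[K] B :=
  Finsupp.linearCombination K
    (fun w => m w.1 (m w.2.1 (v (w.2.2 0)) (v (w.2.2 1))) (v (w.2.2 2)))

lemma map_quadEval {K : Type u} [Field K] {E B C : Type u} [AddCommGroup B] [Module K B]
    [AddCommGroup C] [Module K C] (m : E → B → B → B) (m' : E → C → C → C)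
    (φ : B →ₗ[K] C) (h : ∀ e x y, φ (m e x y) = m' e (φ x) (φ y)) (v : Fin 3 → B)
    (r : E × E × Equiv.Perm (Fin 3) →₀ K) :
    φ (quadEval m v r) = quadEval m' (fun i => φ (v i)) r := by
  simp [quadEval, Finsupp.linearCombination_apply, Finsupp.sum, map_sum, h]

/-- Renaming the operations in relators along a map `E → E'`. -/
def relMap {K : Type u} [Field K] {E E' : Type u} (g : E → E') :
    (E × E × Equiv.Perm (Fin 3) →₀ K) →ₗ[K] (E' × E' × Equiv.Perm (Fin 3) →₀ K) :=
  Finsupp.lmapDomain K K (fun w => (g w.1, g w.2.1, w.2.2))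

lemma linearCombination_relMap {K : Type u} [Field K] {E E' : Type u} (g : E → E')
    {B : Type u} [AddCommGroup B] [Module K B] (F : E' × E' × Equiv.Perm (Fin 3) → B)
    (r : E × E × Equiv.Perm (Fin 3) →₀ K) :
    Finsupp.linearCombination K F (relMap g r) =
      Finsupp.linearCombination K (fun w => F (g w.1, g w.2.1, w.2.2)) r := by
  simp [relMap, Finsupp.linearCombination_mapDomain, Function.comp_def]

namespace QuadData

variable {K : Type u} [Field K]

/-- A morphism of quadratic data: an equivariant map of generators preserving relators. -/
@[ext]
structure Hom (D D' : QuadData K) where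
  map : D.E →ₗ[K] D'.E
  map_swap : ∀ e, map (D.swap e) = D'.swap (map e)
  map_rel : ∀ r ∈ D.rel, relMap map r ∈ D'.rel

instance : Category (QuadData K) where
  Hom := Hom
  id D := ⟨LinearMap.id, fun _ => rfl, fun r hr => by
    have : relMap (K := K) (LinearMap.id : D.E →ₗ[K] D.E) r = r := by
      simp only [relMap, LinearMap.id_coe, id_eq, Finsupp.lmapDomain_apply]
      exact Finsupp.mapDomain_id
    rwa [this]⟩
  comp f g := ⟨g.map ∘ₗ f.map, fun e => by simp [f.map_swap, g.map_swap], fun r hr => by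
    have := g.map_rel _ (f.map_rel r hr)
    have h : relMap (K := K) (g.map ∘ₗ f.map) r = relMap g.map (relMap f.map r) := by
      simp [relMap, ← Finsupp.mapDomain_comp, Function.comp_def]
    rwa [h]⟩

/-- `m` is an algebra structure of type `D` on `B`: binary operations `m e`, `e ∈ E`, with
`m (e^op) x y = m e y x`, for which all the relators vanish. -/
structure IsAlg (D : QuadData K) {B : Type u} [AddCommGroup B] [Module K B]
    (m : D.E →ₗ[K] B →ₗ[K] B →ₗ[K] B) : Prop where
  swap : ∀ e x y, m (D.swap e) x y = m e y x
  rel : ∀ r ∈ D.rel, ∀ v : Fin 3 → B, quadEval (fun e x y => m e x y) v r = 0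

lemma IsAlg.pullback {D D' : QuadData K} (g : Hom D D') {B : Type u} [AddCommGroup B]
    [Module K B] {m : D'.E →ₗ[K] B →ₗ[K] B →ₗ[K] B} (h : D'.IsAlg m) :
    D.IsAlg (m ∘ₗ g.map) where
  swap e x y := by simp [g.map_swap, h.swap]
  rel r hr v := by
    have := h.rel _ (g.map_rel r hr) v
    unfold quadEval at this
    rwa [linearCombination_relMap] at this

/-! ### Free algebras -/

/-- Nonassociative monomials in variables from `ι`, with products labelled by `E`. -/
inductive Term (E : Type u) (ι : Type) : Type u
  | var (i : ι) : Term E ι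
  | node (e : E) (s t : Term E ι) : Term E ι

/-- The list of variables occurring in a monomial. -/
def Term.vars {E : Type u} {ι : Type} : Term E ι → List ι
  | .var i => [i]
  | .node _ s t => s.vars ++ t.vars

/-- The value of a monomial. -/
def Term.eval {E B : Type u} {ι : Type} (m : E → B → B → B) (v : ι → B) : Term E ι → B
  | .var i => v i
  | .node e s t => m e (s.eval m v) (t.eval m v)

/-- The bilinear product labelled by `e` on formal linear combinations of monomials. -/
def preOp (K : Type u) [Field K] {E : Type u} {ι : Type} (e : E) :
    (Term E ι →₀ K) →ₗ[K] (Term E ι →₀ K) →ₗ[K] (Term E ι →₀ K) :=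
  Finsupp.linearCombination K (fun s => Finsupp.linearCombination K
    (fun t => Finsupp.single (Term.node e s t) (1 : K)))

lemma preOp_single {E : Type u} {ι : Type} (e : E) (s t : Term E ι) :
    preOp K e (Finsupp.single s 1) (Finsupp.single t 1) = Finsupp.single (.node e s t) 1 := by
  simp [preOp]

/-- The subspaces `N` of the space of linear combinations of monomials which are ideals for all
the products and modulo which the products depend linearly on their label, are compatible with
`e ↦ e^op`, and satisfy the relators. -/
structure IsRelIdeal (D : QuadData K) {ι : Type} (N : Submodule K (Term D.E ι →₀ K)) :
    Prop where
  left : ∀ e, ∀ x ∈ N, ∀ y, preOp K e x y ∈ N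
  right : ∀ e x, ∀ y ∈ N, preOp K e x y ∈ N
  add : ∀ e e' x y, preOp K (e + e') x y - (preOp K e x y + preOp K e' x y) ∈ N
  smul : ∀ (c : K) e x y, preOp K (c • e) x y - c • preOp K e x y ∈ N
  swap : ∀ e x y, preOp K (D.swap e) x y - preOp K e y x ∈ N
  rel : ∀ r ∈ D.rel, ∀ v, quadEval (fun e x y => preOp K e x y) v r ∈ N

/-- The smallest ideal as above. -/
def relIdeal (D : QuadData K) (ι : Type) : Submodule K (Term D.E ι →₀ K) :=
  sInf {N | D.IsRelIdeal N}

lemma relIdeal_isRelIdeal (D : QuadData K) (ι : Type) : D.IsRelIdeal (D.relIdeal ι) where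
  left e x hx y := by
    rw [relIdeal, Submodule.mem_sInf] at *
    exact fun N hN => hN.left e x (hx N hN) y
  right e x y hy := by
    rw [relIdeal, Submodule.mem_sInf] at *
    exact fun N hN => hN.right e x y (hy N hN)
  add e e' x y := by
    rw [relIdeal, Submodule.mem_sInf]
    exact fun N hN => hN.add e e' x y
  smul c e x y := by
    rw [relIdeal, Submodule.mem_sInf]
    exact fun N hN => hN.smul c e x y
  swap e x y := by
    rw [relIdeal, Submodule.mem_sInf]
    exact fun N hN => hN.swap e x y
  rel r hr v := by
    rw [relIdeal, Submodule.mem_sInf]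
    exact fun N hN => hN.rel r hr v

/-- The free algebra of type `D` on the set `ι`. -/
abbrev FreeAlg (D : QuadData K) (ι : Type) : Type u := (Term D.E ι →₀ K) ⧸ D.relIdeal ι

/-- The quotient map onto the free algebra. -/
def cls (D : QuadData K) (ι : Type) : (Term D.E ι →₀ K) →ₗ[K] D.FreeAlg ι :=
  (D.relIdeal ι).mkQ

lemma cls_surjective (D : QuadData K) (ι : Type) : Function.Surjective (D.cls ι) :=
  Submodule.mkQ_surjective _

lemma cls_eq_zero (D : QuadData K) {ι : Type} (x : Term D.E ι →₀ K) :
    D.cls ι x = 0 ↔ x ∈ D.relIdeal ι := Submodule.Quotient.mk_eq_zero _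

lemma cls_eq (D : QuadData K) {ι : Type} (x y : Term D.E ι →₀ K) :
    D.cls ι x = D.cls ι y ↔ x - y ∈ D.relIdeal ι := by
  rw [← sub_eq_zero, ← map_sub, cls_eq_zero]

/-- The class of a monomial in the free algebra. -/
def mon (D : QuadData K) {ι : Type} (t : Term D.E ι) : D.FreeAlg ι := D.cls ι (Finsupp.single t 1)

/-- The product labelled by `e` in the free algebra. -/
def opAux (D : QuadData K) (ι : Type) (e : D.E) :
    D.FreeAlg ι →ₗ[K] D.FreeAlg ι →ₗ[K] D.FreeAlg ι :=
  (D.relIdeal ι).liftQ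
    { toFun := fun x => (D.relIdeal ι).liftQ (D.cls ι ∘ₗ preOp K e x) (fun y hy =>
        (D.cls_eq_zero _).2 ((D.relIdeal_isRelIdeal ι).right e x y hy))
      map_add' := fun x x' => by
        apply LinearMap.ext
        intro y
        obtain ⟨y, rfl⟩ := D.cls_surjective ι y
        simp [cls]
      map_smul' := fun c x => by
        apply LinearMap.ext
        intro y
        obtain ⟨y, rfl⟩ := D.cls_surjective ι y
        simp [cls] }
    (fun x hx => by
      rw [LinearMap.mem_ker]
      apply LinearMap.ext
      intro y
      obtain ⟨y, rfl⟩ := D.cls_surjective ι y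
      exact (D.cls_eq_zero _).2 ((D.relIdeal_isRelIdeal ι).left e x hx y))

lemma opAux_cls (D : QuadData K) (ι : Type) (e : D.E) (x y : Term D.E ι →₀ K) :
    D.opAux ι e (D.cls ι x) (D.cls ι y) = D.cls ι (preOp K e x y) := rfl

/-- The products of the free algebra. -/
def op (D : QuadData K) (ι : Type) :
    D.E →ₗ[K] D.FreeAlg ι →ₗ[K] D.FreeAlg ι →ₗ[K] D.FreeAlg ι where
  toFun := D.opAux ι
  map_add' e e' := by
    apply LinearMap.ext₂
    intro x y
    obtain ⟨x, rfl⟩ := D.cls_surjective ι x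
    obtain ⟨y, rfl⟩ := D.cls_surjective ι y
    simp only [LinearMap.add_apply, opAux_cls, ← map_add]
    exact (D.cls_eq _ _).2 ((D.relIdeal_isRelIdeal ι).add e e' x y)
  map_smul' c e := by
    apply LinearMap.ext₂
    intro x y
    obtain ⟨x, rfl⟩ := D.cls_surjective ι x
    obtain ⟨y, rfl⟩ := D.cls_surjective ι y
    simp only [LinearMap.smul_apply, opAux_cls, RingHom.id_apply]
    rw [← (D.cls ι).map_smul]
    exact (D.cls_eq _ _).2 ((D.relIdeal_isRelIdeal ι).smul c e x y)

lemma op_cls (D : QuadData K) (ι : Type) (e : D.E) (x y : Term D.E ι →₀ K) :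
    D.op ι e (D.cls ι x) (D.cls ι y) = D.cls ι (preOp K e x y) := rfl

lemma mon_node (D : QuadData K) {ι : Type} (e : D.E) (s t : Term D.E ι) :
    D.mon (.node e s t) = D.op ι e (D.mon s) (D.mon t) := by
  rw [mon, mon, mon, op_cls, preOp_single]

lemma op_isAlg (D : QuadData K) (ι : Type) : D.IsAlg (D.op ι) where
  swap e x y := by
    obtain ⟨x, rfl⟩ := D.cls_surjective ι x
    obtain ⟨y, rfl⟩ := D.cls_surjective ι y
    rw [op_cls, op_cls, cls_eq]
    exact (D.relIdeal_isRelIdeal ι).swap e x y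
  rel r hr v := by
    choose w hw using fun i => D.cls_surjective ι (v i)
    obtain rfl : (fun i => D.cls ι (w i)) = v := funext hw
    rw [← map_quadEval (fun e x y => preOp K e x y) _ (D.cls ι) (fun e x y => rfl),
      cls_eq_zero]
    exact (D.relIdeal_isRelIdeal ι).rel r hr w

section lift

variable (D : QuadData K) {ι : Type} {B : Type u} [AddCommGroup B] [Module K B]
  {m : D.E →ₗ[K] B →ₗ[K] B →ₗ[K] B}

/-- Evaluation of linear combinations of monomials in an algebra. -/
def evalMap (m : D.E →ₗ[K] B →ₗ[K] B →ₗ[K] B) (v : ι → B) : (Term D.E ι →₀ K) →ₗ[K] B :=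
  Finsupp.linearCombination K (Term.eval (fun e x y => m e x y) v)

lemma evalMap_preOp (m : D.E →ₗ[K] B →ₗ[K] B →ₗ[K] B) (v : ι → B) (e : D.E)
    (x y : Term D.E ι →₀ K) :
    D.evalMap m v (preOp K e x y) = m e (D.evalMap m v x) (D.evalMap m v y) := by
  have : (preOp K e).compr₂ (D.evalMap m v) = (m e).compl₁₂ (D.evalMap m v) (D.evalMap m v) := by
    ext s t
    simp [preOp, evalMap, Term.eval]
  exact LinearMap.congr_fun₂ this x y

lemma isRelIdeal_ker (h : D.IsAlg m) (v : ι → B) :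
    D.IsRelIdeal (LinearMap.ker (D.evalMap m v)) where
  left e x hx y := by
    rw [LinearMap.mem_ker] at *
    rw [evalMap_preOp, hx]; simp
  right e x y hy := by
    rw [LinearMap.mem_ker] at *
    rw [evalMap_preOp, hy]; simp
  add e e' x y := by
    rw [LinearMap.mem_ker]
    simp [evalMap_preOp]
  smul c e x y := by
    rw [LinearMap.mem_ker]
    simp [evalMap_preOp]
  swap e x y := by
    rw [LinearMap.mem_ker]
    simp [evalMap_preOp, h.swap]
  rel r hr w := by
    rw [LinearMap.mem_ker, map_quadEval _ (fun e x y => m e x y) (D.evalMap m v)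
      (fun e x y => D.evalMap_preOp m v e x y)]
    exact h.rel r hr _

/-- The morphism from the free algebra given by the values of the variables. -/
def lift (h : D.IsAlg m) (v : ι → B) : D.FreeAlg ι →ₗ[K] B :=
  (D.relIdeal ι).liftQ (D.evalMap m v) (sInf_le (D.isRelIdeal_ker h v))

lemma lift_cls (h : D.IsAlg m) (v : ι → B) (x : Term D.E ι →₀ K) :
    D.lift h v (D.cls ι x) = D.evalMap m v x := rfl

lemma lift_mon (h : D.IsAlg m) (v : ι → B) (t : Term D.E ι) :
    D.lift h v (D.mon t) = t.eval (fun e x y => m e x y) v := by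
  rw [mon, lift_cls]
  simp [evalMap]

lemma lift_var (h : D.IsAlg m) (v : ι → B) (i : ι) :
    D.lift h v (D.mon (.var i)) = v i := lift_mon ..

lemma lift_op (h : D.IsAlg m) (v : ι → B) (e : D.E) (x y : D.FreeAlg ι) :
    D.lift h v (D.op ι e x y) = m e (D.lift h v x) (D.lift h v y) := by
  obtain ⟨x, rfl⟩ := D.cls_surjective ι x
  obtain ⟨y, rfl⟩ := D.cls_surjective ι y
  rw [op_cls, lift_cls, lift_cls, lift_cls, evalMap_preOp]

lemma hom_ext_aux {φ ψ : D.FreeAlg ι →ₗ[K] B}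
    (hφ : ∀ e x y, φ (D.op ι e x y) = m e (φ x) (φ y))
    (hψ : ∀ e x y, ψ (D.op ι e x y) = m e (ψ x) (ψ y))
    (hv : ∀ i, φ (D.mon (.var i)) = ψ (D.mon (.var i))) (x : D.FreeAlg ι) : φ x = ψ x := by
  have key : ∀ t : Term D.E ι, φ (D.mon t) = ψ (D.mon t) := by
    intro t
    induction t with
    | var i => exact hv i
    | node e s t hs ht => rw [mon_node, hφ, hψ, hs, ht]
  obtain ⟨x, rfl⟩ := D.cls_surjective ι x
  have : φ ∘ₗ D.cls ι = ψ ∘ₗ D.cls ι := by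
    ext t
    exact key t
  exact LinearMap.congr_fun this x

lemma lift_lift {κ : Type} (h : D.IsAlg m) (v : ι → D.FreeAlg κ) (w : κ → B)
    (x : D.FreeAlg ι) :
    D.lift h w (D.lift (D.op_isAlg κ) v x) = D.lift h (fun i => D.lift h w (v i)) x :=
  D.hom_ext_aux (φ := D.lift h w ∘ₗ D.lift (D.op_isAlg κ) v) (m := m)
    (fun e x y => by simp [lift_op]) (fun e x y => by simp [lift_op])
    (fun i => by simp [lift_var]) x

lemma lift_self (x : D.FreeAlg ι) : D.lift (D.op_isAlg ι) (fun i => D.mon (.var i)) x = x :=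
  D.hom_ext_aux (ψ := LinearMap.id) (m := D.op ι) (fun e x y => by simp [lift_op])
    (fun e x y => by simp) (fun i => by simp [lift_var]) x

end lift

/-! ### The operad defined by quadratic data -/

/-- The span of the monomials in which the variables in `X` occur exactly once, and the others do
not occur. -/
def multilin (D : QuadData K) {ι : Type} (X : Set ι) : Submodule K (D.FreeAlg ι) :=
  Submodule.span K {a | ∃ t : Term D.E ι, t.vars.Nodup ∧ (∀ i, i ∈ t.vars ↔ i ∈ X) ∧ D.mon t = a}

lemma op_mem_multilin (D : QuadData K) {ι : Type} {X Y : Set ι} (hXY : Disjoint X Y) (e : D.E)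
    {a b : D.FreeAlg ι} (ha : a ∈ D.multilin X) (hb : b ∈ D.multilin Y) :
    D.op ι e a b ∈ D.multilin (X ∪ Y) := by
  induction ha using Submodule.span_induction with
  | zero => simp
  | add x y _ _ hx hy => rw [map_add]; exact add_mem hx hy
  | smul c x _ hx => rw [map_smul]; exact Submodule.smul_mem _ c hx
  | mem a ha =>
    obtain ⟨s, hs, hsX, rfl⟩ := ha
    induction hb using Submodule.span_induction with
    | zero => simp
    | add x y _ _ hx hy => rw [map_add]; exact add_mem hx hy
    | smul c x _ hx => rw [map_smul]; exact Submodule.smul_mem _ c hx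
    | mem b hb =>
      obtain ⟨t, ht, htY, rfl⟩ := hb
      refine Submodule.subset_span ⟨.node e s t, ?_, ?_, D.mon_node e s t⟩
      · refine List.Nodup.append hs ht ?_
        intro i hi hi'
        exact Set.disjoint_left.1 hXY ((hsX i).1 hi) ((htY i).1 hi')
      · intro i
        simp [Term.vars, hsX, htY]

lemma eval_mem_multilin (D : QuadData K) {ι κ : Type} (Y : ι → Set κ)
    (hY : ∀ i j, i ≠ j → Disjoint (Y i) (Y j)) (v : ι → D.FreeAlg κ)
    (hv : ∀ i, v i ∈ D.multilin (Y i)) (t : Term D.E ι) (ht : t.vars.Nodup) :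
    t.eval (fun e x y => D.op κ e x y) v ∈ D.multilin (⋃ i ∈ t.vars, Y i) := by
  induction t with
  | var i => simpa [Term.vars, Term.eval] using hv i
  | node e s t hs ht' =>
    have h := List.nodup_append.1 ht
    have hu : (⋃ i ∈ (Term.node e s t).vars, Y i) =
        (⋃ i ∈ s.vars, Y i) ∪ (⋃ i ∈ t.vars, Y i) := by
      ext x
      simp only [Term.vars, List.mem_append, Set.mem_iUnion, Set.mem_union]
      grind
    rw [hu]
    refine D.op_mem_multilin ?_ e (hs h.1) (ht' h.2.1)
    simp only [Set.disjoint_iUnion_left, Set.disjoint_iUnion_right]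
    intro i hi j hj
    exact hY _ _ (by first | exact h.2.2 _ hi _ hj | exact (h.2.2 _ hj _ hi))

lemma lift_mem_multilin (D : QuadData K) {ι κ : Type} (Y : ι → Set κ)
    (hY : ∀ i j, i ≠ j → Disjoint (Y i) (Y j)) (v : ι → D.FreeAlg κ)
    (hv : ∀ i, v i ∈ D.multilin (Y i)) (X : Set ι) {p : D.FreeAlg ι} (hp : p ∈ D.multilin X) :
    D.lift (D.op_isAlg κ) v p ∈ D.multilin (⋃ i ∈ X, Y i) := by
  induction hp using Submodule.span_induction with
  | zero => simp
  | add x y _ _ hx hy => rw [map_add]; exact add_mem hx hy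
  | smul c x _ hx => rw [map_smul]; exact Submodule.smul_mem _ c hx
  | mem a ha =>
    obtain ⟨t, ht, htX, rfl⟩ := ha
    have := D.eval_mem_multilin Y hY v hv t ht
    simpa only [htX, lift_mon] using this

lemma var_mem_multilin (D : QuadData K) {ι : Type} (i : ι) :
    D.mon (.var i) ∈ D.multilin {i} :=
  Submodule.subset_span ⟨.var i, by simp [Term.vars], by simp [Term.vars], rfl⟩

/-- Renaming of variables in a free algebra. -/
def rename (D : QuadData K) {ι κ : Type} (f : ι → κ) : D.FreeAlg ι →ₗ[K] D.FreeAlg κ :=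
  D.lift (D.op_isAlg κ) (fun i => D.mon (.var (f i)))

lemma rename_mem_multilin (D : QuadData K) {ι κ : Type} (f : ι → κ) (hf : Function.Injective f)
    {p : D.FreeAlg ι} (hp : p ∈ D.multilin Set.univ) :
    D.rename f p ∈ D.multilin (Set.range f) := by
  have := D.lift_mem_multilin (fun i => {f i}) (fun i j hij => by simpa using hf.ne hij)
    (fun i => D.mon (.var (f i))) (fun i => D.var_mem_multilin _) Set.univ hp
  have hr : (⋃ i ∈ (Set.univ : Set ι), {f i}) = Set.range f := by
    ext x
    simp [eq_comm]
  rwa [hr] at this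

lemma rename_var (D : QuadData K) {ι κ : Type} (f : ι → κ) (i : ι) :
    D.rename f (D.mon (.var i)) = D.mon (.var (f i)) := D.lift_var ..

lemma lift_rename (D : QuadData K) {ι κ : Type} (f : ι → κ) {B : Type u} [AddCommGroup B]
    [Module K B] {m : D.E →ₗ[K] B →ₗ[K] B →ₗ[K] B} (h : D.IsAlg m) (v : κ → B)
    (x : D.FreeAlg ι) : D.lift h v (D.rename f x) = D.lift h (fun i => v (f i)) x := by
  simp [rename, lift_lift, lift_var]

lemma rename_lift (D : QuadData K) {ι κ l : Type} (f : κ → l) (v : ι → D.FreeAlg κ)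
    (x : D.FreeAlg ι) : D.rename f (D.lift (D.op_isAlg κ) v x) =
      D.lift (D.op_isAlg l) (fun i => D.rename f (v i)) x := by
  simp [rename, lift_lift]

lemma eval_update_of_notMem {E B : Type u} {ι : Type} [DecidableEq ι] (m : E → B → B → B)
    (v : ι → B) (i : ι) (x : B) (t : Term E ι) (h : i ∉ t.vars) :
    t.eval m (Function.update v i x) = t.eval m v := by
  induction t with
  | var j =>
    have : j ≠ i := by rintro rfl; simp [Term.vars] at h
    simp [Term.eval, this]
  | node e s t hs ht =>
    simp only [Term.vars, List.mem_append, not_or] at h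
    simp [Term.eval, hs h.1, ht h.2]

lemma eval_update_add (D : QuadData K) {ι : Type} [DecidableEq ι] {B : Type u} [AddCommGroup B]
    [Module K B] (m : D.E →ₗ[K] B →ₗ[K] B →ₗ[K] B) (v : ι → B) (i : ι) (x y : B)
    (t : Term D.E ι) (h : t.vars.Nodup) (hi : i ∈ t.vars) :
    t.eval (fun e x y => m e x y) (Function.update v i (x + y)) =
      t.eval (fun e x y => m e x y) (Function.update v i x) +
      t.eval (fun e x y => m e x y) (Function.update v i y) := by
  induction t with
  | var j =>
    obtain rfl : i = j := by simpa [Term.vars] using hi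
    simp [Term.eval]
  | node e s t hs ht =>
    have h' := List.nodup_append'.1 h
    rcases List.mem_append.1 hi with h1 | h1
    · have h2 : i ∉ t.vars := fun h2 => h'.2.2 h1 h2
      simp only [Term.eval, hs h'.1 h1, eval_update_of_notMem _ _ _ _ t h2, map_add,
        LinearMap.add_apply]
    · have h2 : i ∉ s.vars := fun h2 => h'.2.2 h2 h1
      simp only [Term.eval, ht h'.2.1 h1, eval_update_of_notMem _ _ _ _ s h2, map_add]

lemma eval_update_smul (D : QuadData K) {ι : Type} [DecidableEq ι] {B : Type u} [AddCommGroup B]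
    [Module K B] (m : D.E →ₗ[K] B →ₗ[K] B →ₗ[K] B) (v : ι → B) (i : ι) (c : K) (x : B)
    (t : Term D.E ι) (h : t.vars.Nodup) (hi : i ∈ t.vars) :
    t.eval (fun e x y => m e x y) (Function.update v i (c • x)) =
      c • t.eval (fun e x y => m e x y) (Function.update v i x) := by
  induction t with
  | var j =>
    obtain rfl : i = j := by simpa [Term.vars] using hi
    simp [Term.eval]
  | node e s t hs ht =>
    have h' := List.nodup_append'.1 h
    rcases List.mem_append.1 hi with h1 | h1
    · have h2 : i ∉ t.vars := fun h2 => h'.2.2 h1 h2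
      simp only [Term.eval, hs h'.1 h1, eval_update_of_notMem _ _ _ _ t h2, map_smul,
        LinearMap.smul_apply]
    · have h2 : i ∉ s.vars := fun h2 => h'.2.2 h2 h1
      simp only [Term.eval, ht h'.2.1 h1, eval_update_of_notMem _ _ _ _ s h2, map_smul]

/-- The multilinear operation on an algebra defined by a multilinear element of the free
algebra. -/
def multilinEval (D : QuadData K) {ι : Type} {B : Type u} [AddCommGroup B]
    [Module K B] {m : D.E →ₗ[K] B →ₗ[K] B →ₗ[K] B} (h : D.IsAlg m) :
    D.multilin (Set.univ : Set ι) →ₗ[K] MultilinearMap K (fun _ : ι => B) B where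
  toFun p :=
    { toFun := fun v => D.lift h v p.1
      map_update_add' := by
        intro _ v i x y
        obtain ⟨p, hp⟩ := p
        dsimp only
        induction hp using Submodule.span_induction with
        | zero => simp
        | add a b _ _ ha hb => simp only [map_add, ha, hb]; abel
        | smul c a _ ha => simp only [map_smul, ha, smul_add]
        | mem a ha =>
          obtain ⟨t, ht, htX, rfl⟩ := ha
          simpa only [lift_mon] using D.eval_update_add m v i x y t ht ((htX i).2 trivial)
      map_update_smul' := by
        intro _ v i c x
        obtain ⟨p, hp⟩ := p
        dsimp only
        induction hp using Submodule.span_induction with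
        | zero => simp
        | add a b _ _ ha hb => simp only [map_add, ha, hb, smul_add]
        | smul c a _ ha => simp only [map_smul, ha, smul_comm c]
        | mem a ha =>
          obtain ⟨t, ht, htX, rfl⟩ := ha
          simpa only [lift_mon] using D.eval_update_smul m v i c x t ht ((htX i).2 trivial) }
  map_add' p q := by ext v; simp
  map_smul' c p := by ext v; simp

lemma multilinEval_apply (D : QuadData K) {ι : Type} {B : Type u} [AddCommGroup B]
    [Module K B] {m : D.E →ₗ[K] B →ₗ[K] B →ₗ[K] B} (h : D.IsAlg m)
    (p : D.multilin (Set.univ : Set ι)) (v : ι → B) :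
    D.multilinEval h p v = D.lift h v p.1 := rfl

lemma substitution_mem (D : QuadData K) {ι : Type} {κ : ι → Type}
    (p : D.multilin (Set.univ : Set ι)) (q : ∀ i, D.multilin (Set.univ : Set (κ i))) :
    D.lift (D.op_isAlg (Σ i, κ i)) (fun i => D.rename (Sigma.mk i) (q i).1) p.1 ∈
      D.multilin (Set.univ : Set (Σ i, κ i)) := by
  have := D.lift_mem_multilin (κ := Σ i, κ i) (fun i => Set.range (Sigma.mk i))
    (fun i j hij => by
      rw [Set.disjoint_left]
      rintro _ ⟨x, rfl⟩ ⟨y, hy⟩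
      exact hij (congrArg Sigma.fst hy).symm)
    (fun i => D.rename (Sigma.mk i) (q i).1)
    (fun i => D.rename_mem_multilin _ sigma_mk_injective (q i).2) Set.univ p.2
  have hr : (⋃ i ∈ (Set.univ : Set ι), Set.range (Sigma.mk (β := κ) i)) = Set.univ := by
    ext x
    simp only [Set.mem_univ, Set.iUnion_true, Set.mem_iUnion, Set.mem_range, iff_true]
    exact ⟨x.1, x.2, rfl⟩
  rwa [hr] at this

lemma rename_equiv_mem (D : QuadData K) {ι κ : Type} (e : ι ≃ κ) (p : D.FreeAlg ι)
    (hp : p ∈ D.multilin (Set.univ : Set ι)) :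
    D.rename e p ∈ D.multilin (Set.univ : Set κ) := by
  have := D.rename_mem_multilin e e.injective hp
  rwa [e.surjective.range_eq] at this

lemma subtype_update {ι : Type} [DecidableEq ι] {κ : ι → Type} (D : QuadData K) {B : Type u}
    [AddCommGroup B] [Module K B]
    (f : ∀ i, D.FreeAlg (κ i) →ₗ[K] B)
    (q : ∀ i, D.multilin (Set.univ : Set (κ i))) (i : ι)
    (x : D.multilin (Set.univ : Set (κ i))) :
    (fun j => f j (Function.update q i x j).1) =
      Function.update (fun j => f j (q j).1) i (f i x.1) := by
  funext j
  by_cases h : j = i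
  · subst h; simp
  · simp [h]

/-- Relabelling of multilinear elements. -/
def relabelMap (D : QuadData K) {ι κ : Type} (e : ι ≃ κ) :
    D.multilin (Set.univ : Set ι) →ₗ[K] D.multilin (Set.univ : Set κ) :=
  (D.rename e).restrict (D.rename_equiv_mem e)

lemma relabelMap_coe (D : QuadData K) {ι κ : Type} (e : ι ≃ κ)
    (p : D.multilin (Set.univ : Set ι)) : (D.relabelMap e p).1 = D.rename e p.1 := rfl

/-- Substitution of multilinear elements in a multilinear element. -/
def subst (D : QuadData K) {ι : Type} {κ : ι → Type} :
    D.multilin (Set.univ : Set ι) →ₗ[K]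
      MultilinearMap K (fun i => D.multilin (Set.univ : Set (κ i)))
        (D.multilin (Set.univ : Set (Σ i, κ i))) where
  toFun p :=
    { toFun := fun q => ⟨_, D.substitution_mem p q⟩
      map_update_add' := by
        intro _ q i x y
        apply Subtype.ext
        change D.lift _ _ _ = D.lift _ _ _ + D.lift _ _ _
        rw [D.subtype_update, D.subtype_update, D.subtype_update, Submodule.coe_add, map_add]
        exact (D.multilinEval (D.op_isAlg _) p).map_update_add _ _ _ _
      map_update_smul' := by
        intro _ q i c x
        apply Subtype.ext
        change D.lift _ _ _ = c • D.lift _ _ _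
        rw [D.subtype_update, D.subtype_update, Submodule.coe_smul, map_smul]
        exact (D.multilinEval (D.op_isAlg _) p).map_update_smul _ _ _ _ }
  map_add' p p' := by
    apply MultilinearMap.ext
    intro q
    apply Subtype.ext
    simp
  map_smul' c p := by
    apply MultilinearMap.ext
    intro q
    apply Subtype.ext
    simp

lemma subst_coe (D : QuadData K) {ι : Type} {κ : ι → Type}
    (p : D.multilin (Set.univ : Set ι)) (q : ∀ i, D.multilin (Set.univ : Set (κ i))) :
    (D.subst p q).1 =
      D.lift (D.op_isAlg (Σ i, κ i)) (fun i => D.rename (Sigma.mk i) (q i).1) p.1 := rfl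

lemma rename_rename (D : QuadData K) {ι κ l : Type} (f : ι → κ) (g : κ → l)
    (x : D.FreeAlg ι) : D.rename g (D.rename f x) = D.rename (g ∘ f) x := by
  simp [rename, lift_lift, lift_var]

/-- The operad `F(E)/(R)` defined by quadratic data: `P(ι)` is the multilinear part of the free
algebra on `ι`, and composition is substitution. -/
abbrev operad (D : QuadData K) : SymOperad K where
  obj ι _ := D.multilin (Set.univ : Set ι)
  grp _ _ := inferInstance
  mod _ _ := inferInstance
  relabel e := D.relabelMap e
  one := ⟨D.mon (.var ()), by
    have := D.var_mem_multilin ()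
    rwa [show ({()} : Set Unit) = Set.univ from Set.eq_univ_of_forall fun _ => rfl] at this⟩
  comp := D.subst
  relabel_refl p := Subtype.ext (D.lift_self p.1)
  relabel_trans e f p := Subtype.ext (by
    simp only [relabelMap_coe, rename_rename]
    rfl)
  comp_relabel_left e p q := Subtype.ext (by
    simp only [relabelMap_coe, subst_coe, lift_rename, rename_lift, rename_rename]
    rfl)
  comp_relabel_right f p q := Subtype.ext (by
    simp only [relabelMap_coe, subst_coe, rename_lift, rename_rename]
    rfl)
  one_comp q := Subtype.ext (by
    simp only [relabelMap_coe, subst_coe, lift_var]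
    rfl)
  comp_one p := Subtype.ext (by
    simp only [relabelMap_coe, subst_coe, rename_var]
    rfl)
  comp_assoc p q r := Subtype.ext (by
    simp only [relabelMap_coe, subst_coe, lift_lift, rename_lift, lift_rename, rename_rename]
    rfl)

/-- The generating operation of the operad `F(E)/(R)` given by `e ∈ E`. -/
def gen (D : QuadData K) : D.E →ₗ[K] D.operad.obj (Fin 2) where
  toFun e := ⟨D.mon (.node e (.var 0) (.var 1)), Submodule.subset_span
    ⟨_, by simp [Term.vars], by simp [Term.vars], rfl⟩⟩
  map_add' e f := Subtype.ext (by
    change D.mon _ = D.mon _ + D.mon _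
    simp [mon_node])
  map_smul' c e := Subtype.ext (by
    change D.mon _ = c • D.mon _
    simp [mon_node])

/-- The morphism of free algebras induced by a morphism of quadratic data. -/
def freeMap {D D' : QuadData K} (g : Hom D D') (ι : Type) : D.FreeAlg ι →ₗ[K] D'.FreeAlg ι :=
  D.lift ((D'.op_isAlg ι).pullback g) (fun i => D'.mon (.var i))

lemma freeMap_var {D D' : QuadData K} (g : Hom D D') {ι : Type} (i : ι) :
    freeMap g ι (D.mon (.var i)) = D'.mon (.var i) := D.lift_var ..

lemma freeMap_op {D D' : QuadData K} (g : Hom D D') {ι : Type} (e : D.E) (x y : D.FreeAlg ι) :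
    freeMap g ι (D.op ι e x y) = D'.op ι (g.map e) (freeMap g ι x) (freeMap g ι y) :=
  D.lift_op ..

lemma freeMap_lift {D D' : QuadData K} (g : Hom D D') {ι κ : Type} (v : ι → D.FreeAlg κ)
    (x : D.FreeAlg ι) : freeMap g κ (D.lift (D.op_isAlg κ) v x) =
      D'.lift (D'.op_isAlg κ) (fun i => freeMap g κ (v i)) (freeMap g ι x) :=
  D.hom_ext_aux (φ := freeMap g κ ∘ₗ D.lift (D.op_isAlg κ) v)
    (ψ := D'.lift (D'.op_isAlg κ) (fun i => freeMap g κ (v i)) ∘ₗ freeMap g ι)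
    (m := D'.op κ ∘ₗ g.map)
    (fun e x y => by simp [lift_op, freeMap_op]) (fun e x y => by simp [lift_op, freeMap_op])
    (fun i => by simp [lift_var, freeMap_var]) x

lemma freeMap_rename {D D' : QuadData K} (g : Hom D D') {ι κ : Type} (f : ι → κ)
    (x : D.FreeAlg ι) : freeMap g κ (D.rename f x) = D'.rename f (freeMap g ι x) := by
  simp only [rename, freeMap_lift, freeMap_var]

lemma freeMap_id (D : QuadData K) {ι : Type} (x : D.FreeAlg ι) : freeMap (𝟙 D) ι x = x :=
  D.hom_ext_aux (ψ := LinearMap.id) (m := D.op ι) (fun e x y => freeMap_op (𝟙 D) e x y)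
    (fun _ _ _ => rfl) (fun _ => freeMap_var _ _) x

lemma freeMap_comp {D D' D'' : QuadData K} (f : D ⟶ D') (g : D' ⟶ D'') {ι : Type}
    (x : D.FreeAlg ι) : freeMap (f ≫ g) ι x = freeMap g ι (freeMap f ι x) :=
  D.hom_ext_aux (φ := freeMap (f ≫ g) ι) (ψ := freeMap g ι ∘ₗ freeMap f ι)
    (m := D''.op ι ∘ₗ (g.map ∘ₗ f.map))
    (fun e x y => freeMap_op (f ≫ g) e x y)
    (fun e x y => by simp [freeMap_op]) (fun i => by simp [freeMap_var]) x

lemma freeMap_mem {D D' : QuadData K} (g : Hom D D') {ι : Type} {X : Set ι}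
    (p : D.FreeAlg ι) (hp : p ∈ D.multilin X) : freeMap g ι p ∈ D'.multilin X := by
  have key : ∀ t : Term D.E ι, ∃ t' : Term D'.E ι, t'.vars = t.vars ∧
      freeMap g ι (D.mon t) = D'.mon t' := by
    intro t
    induction t with
    | var i => exact ⟨.var i, rfl, freeMap_var _ _⟩
    | node e s t hs ht =>
      obtain ⟨s', h1, h2⟩ := hs
      obtain ⟨t', h3, h4⟩ := ht
      exact ⟨.node (g.map e) s' t', by simp [Term.vars, h1, h3],
        by rw [mon_node, freeMap_op, h2, h4, mon_node]⟩
  induction hp using Submodule.span_induction with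
  | zero => simp
  | add x y _ _ hx hy => rw [map_add]; exact add_mem hx hy
  | smul c x _ hx => rw [map_smul]; exact Submodule.smul_mem _ c hx
  | mem a ha =>
    obtain ⟨t, ht, htX, rfl⟩ := ha
    obtain ⟨t', h1, h2⟩ := key t
    exact Submodule.subset_span ⟨t', by rwa [h1], by rwa [h1], h2.symm⟩

/-- The functor sending quadratic data `(E, R)` to the operad `F(E)/(R)`. -/
def operadFunctor (K : Type u) [Field K] : QuadData K ⥤ SymOperad K where
  obj D := D.operad
  map {D D'} g :=
    { app := fun ι _ => (freeMap g ι).restrict (freeMap_mem g)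
      app_relabel := fun e p => Subtype.ext (freeMap_rename g e p.1)
      app_one := Subtype.ext (freeMap_var g ())
      app_comp := fun {ι _ κ _} p q => Subtype.ext (by
        refine (freeMap_lift g _ p.1).trans ?_
        simp only [freeMap_rename]
        rfl) }
  map_id D := SymOperad.hom_ext fun ι _ p => Subtype.ext (freeMap_id D p.1)
  map_comp f g := SymOperad.hom_ext fun ι _ p => Subtype.ext (freeMap_comp f g p.1)

lemma vars_ne_nil {E : Type u} {ι : Type} (t : Term E ι) : t.vars ≠ [] := by
  induction t with
  | var i => simp [Term.vars]
  | node e s t hs ht => simp [Term.vars, hs]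

lemma eq_var_of_length {E : Type u} {ι : Type} (t : Term E ι) (h : t.vars.length ≤ 1) :
    ∃ i, t = .var i := by
  cases t with
  | var i => exact ⟨i, rfl⟩
  | node e s t =>
    have h1 := List.length_pos_iff.2 (vars_ne_nil s)
    have h2 := List.length_pos_iff.2 (vars_ne_nil t)
    simp only [Term.vars, List.length_append] at h
    omega

/-- The binary operations of `F(E)/(R)` are all given by elements of `E`. -/
lemma gen_surjective (D : QuadData K) (p : D.operad.obj (Fin 2)) : ∃ e, D.gen e = p := by
  obtain ⟨p, hp⟩ := p
  suffices ∃ e, D.op (Fin 2) e (D.mon (.var 0)) (D.mon (.var 1)) = p by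
    obtain ⟨e, he⟩ := this
    exact ⟨e, Subtype.ext ((D.mon_node _ _ _).trans he)⟩
  induction hp using Submodule.span_induction with
  | zero => exact ⟨0, by simp⟩
  | add x y _ _ hx hy =>
    obtain ⟨e, rfl⟩ := hx
    obtain ⟨f, rfl⟩ := hy
    exact ⟨e + f, by simp⟩
  | smul c x _ hx =>
    obtain ⟨e, rfl⟩ := hx
    exact ⟨c • e, by simp⟩
  | mem a ha =>
    obtain ⟨t, ht, htX, rfl⟩ := ha
    have hlen : t.vars.length = 2 := by
      have h1 := ht.length_le_card
      have h2 : Finset.univ ⊆ t.vars.toFinset := fun i _ => by simp [htX]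
      have h3 := Finset.card_le_card h2
      have h4 := t.vars.toFinset_card_le
      simp at h1 h3
      omega
    cases t with
    | var i => simp [Term.vars] at hlen
    | node e s t =>
      have h1 := List.length_pos_iff.2 (vars_ne_nil s)
      have h2 := List.length_pos_iff.2 (vars_ne_nil t)
      simp only [Term.vars, List.length_append] at hlen
      obtain ⟨i, rfl⟩ := eq_var_of_length s (by omega)
      obtain ⟨j, rfl⟩ := eq_var_of_length t (by omega)
      have hij : i ≠ j := by simpa [Term.vars] using ht
      rw [mon_node]
      fin_cases i <;> fin_cases j
      · exact absurd rfl hij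
      · exact ⟨e, rfl⟩
      · exact ⟨D.swap e, (D.op_isAlg _).swap _ _ _⟩
      · exact absurd rfl hij

lemma finite_binary (D : QuadData K) [Module.Finite K D.E] :
    Module.Finite K (D.operad.obj (Fin 2)) :=
  Module.Finite.of_surjective D.gen D.gen_surjective

end QuadData

/-- An operad is binary, quadratic and finitely generated if it is of the form `F(E)/(R)` with
`E` finite dimensional. -/
def IsBinaryQuadratic (K : Type u) [Field K] : ObjectProperty (SymOperad K) := fun P =>
  ∃ D : QuadData K, Module.Finite K D.E ∧ Nonempty (P ≅ D.operad)

/-- The category of finitely generated binary quadratic operads. -/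
abbrev Op (K : Type u) [Field K] := (IsBinaryQuadratic K).FullSubcategory

lemma isBinaryQuadratic_operad {K : Type u} [Field K] (D : QuadData K) [h : Module.Finite K D.E] :
    IsBinaryQuadratic K D.operad := ⟨D, h, ⟨Iso.refl _⟩⟩

lemma Op.finite_binary {K : Type u} [Field K] (O : Op K) :
    Module.Finite K (O.obj.obj (Fin 2)) := by
  obtain ⟨D, hD, ⟨φ⟩⟩ := O.property
  have := D.finite_binary
  refine Module.Finite.of_surjective (SymOperad.Hom.app φ.inv (Fin 2)) (fun p => ?_)
  refine ⟨SymOperad.Hom.app φ.hom (Fin 2) p, ?_⟩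
  rw [← SymOperad.comp_app, φ.hom_inv_id, SymOperad.id_app]

/-! ## The operad of right permutative algebras -/

/-- The space of operations spanned by a single nonsymmetric operation `μ = (1, 0)` and its
opposite `μ^op = (0, 1)`, and the right permutative relations
`(x₀ x₁) x₂ = x₀ (x₁ x₂)` and `x₀ (x₁ x₂) = x₀ (x₂ x₁)`. They are written through
`x₀ (x₁ x₂) = μ^op(μ(x₁, x₂), x₀)`. -/
abbrev permData (K : Type u) [Field K] : QuadData K where
  E := K × K
  swap := (LinearEquiv.prodComm K K K).toLinearMap
  swap_swap _ := rfl
  rel := {Finsupp.single ((1, 0), (1, 0), 1) 1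
            - Finsupp.single ((0, 1), (1, 0), finRotate 3) 1,
          Finsupp.single ((0, 1), (1, 0), finRotate 3) 1
            - Finsupp.single ((0, 1), (0, 1), finRotate 3) 1}

/-- The operad of right permutative algebras. -/
def permOp (K : Type u) [Field K] : Op K :=
  ⟨(permData K).operad, @isBinaryQuadratic_operad _ _ _
    (inferInstanceAs (Module.Finite K (K × K)))⟩

/-- The generating product of the operad of right permutative algebras. -/
def permMul (K : Type u) [Field K] : (permOp K).obj.obj (Fin 2) :=
  (permData K).gen ((1, 0) : K × K)

/-! ## The Manin white product -/

/-- The value in `P(3) ⊗ Q(3)` of quadratic expressions in the operations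
`p ⊗ q ∈ P(2) ⊗ Q(2)`. -/
def whiteEval {K : Type u} [Field K] (P Q : SymOperad K) :
    ((P.obj (Fin 2) ⊗[K] Q.obj (Fin 2)) × (P.obj (Fin 2) ⊗[K] Q.obj (Fin 2)) ×
      Equiv.Perm (Fin 3) →₀ K) →ₗ[K] P.obj (Fin 3) ⊗[K] Q.obj (Fin 3) :=
  Finsupp.linearCombination K (fun w =>
    TensorProduct.map (P.relabel w.2.2) (Q.relabel w.2.2)
      (TensorProduct.map₂ P.leftComb Q.leftComb w.1 w.2.1))

/-- The quadratic data of the white product: generators `P(2) ⊗ Q(2)`, and as relators the kernel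
of the map from the arity three part of the free operad on `P(2) ⊗ Q(2)` to `P(3) ⊗ Q(3)`. -/
abbrev whiteData {K : Type u} [Field K] (P Q : SymOperad K) : QuadData K where
  E := P.obj (Fin 2) ⊗[K] Q.obj (Fin 2)
  swap := TensorProduct.map P.swap Q.swap
  swap_swap e := by
    have : TensorProduct.map P.swap Q.swap ∘ₗ TensorProduct.map P.swap Q.swap =
        LinearMap.id := by
      ext p q
      simp [P.swap_swap, Q.swap_swap]
    exact LinearMap.congr_fun this e
  rel := {r | whiteEval P Q r = 0}

lemma whiteEval_relMap {K : Type u} [Field K] (P : SymOperad K) {Q Q' : SymOperad K}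
    (φ : SymOperad.Hom Q Q') (r) :
    whiteEval P Q' (relMap (TensorProduct.map LinearMap.id (φ.app (Fin 2))) r) =
      TensorProduct.map LinearMap.id (φ.app (Fin 3)) (whiteEval P Q r) := by
  have h1 : ∀ x y : P.obj (Fin 2) ⊗[K] Q.obj (Fin 2),
      TensorProduct.map₂ P.leftComb Q'.leftComb
        (TensorProduct.map LinearMap.id (φ.app (Fin 2)) x)
        (TensorProduct.map LinearMap.id (φ.app (Fin 2)) y) =
      TensorProduct.map LinearMap.id (φ.app (Fin 3))
        (TensorProduct.map₂ P.leftComb Q.leftComb x y) := by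
    intro x y
    induction x with
    | zero => simp
    | add x x' hx hx' => simp only [map_add, LinearMap.add_apply, hx, hx']
    | tmul p q =>
      induction y with
      | zero => simp
      | add x x' hx hx' => simp only [map_add, hx, hx']
      | tmul p' q' => simp [TensorProduct.map₂_apply_tmul, φ.app_leftComb]
  have h2 : ∀ (σ : Equiv.Perm (Fin 3)) (z : P.obj (Fin 3) ⊗[K] Q.obj (Fin 3)),
      TensorProduct.map (P.relabel σ) (Q'.relabel σ)
        (TensorProduct.map LinearMap.id (φ.app (Fin 3)) z) =
      TensorProduct.map LinearMap.id (φ.app (Fin 3))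
        (TensorProduct.map (P.relabel σ) (Q.relabel σ) z) := by
    intro σ z
    induction z with
    | zero => simp
    | add x x' hx hx' => simp only [map_add, hx, hx']
    | tmul p q => simp [φ.app_relabel]
  rw [whiteEval, linearCombination_relMap]
  simp only [h1, h2, whiteEval, Finsupp.linearCombination_apply, Finsupp.sum, map_sum, map_smul]

/-- Functoriality of the white product. -/
def whiteMap {K : Type u} [Field K] (P : SymOperad K) {Q Q' : SymOperad K}
    (φ : SymOperad.Hom Q Q') : whiteData P Q ⟶ whiteData P Q' where
  map := TensorProduct.map LinearMap.id (φ.app (Fin 2))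
  map_swap e := by
    change (TensorProduct.map LinearMap.id (φ.app (Fin 2)) ∘ₗ TensorProduct.map P.swap Q.swap) e =
      (TensorProduct.map P.swap Q'.swap ∘ₗ TensorProduct.map LinearMap.id (φ.app (Fin 2))) e
    congr 1
    ext p q
    simp [SymOperad.swap, φ.app_relabel]
  map_rel r hr := by
    exact (whiteEval_relMap P φ r).trans ((congrArg _ hr).trans (map_zero _))

/-- The functor sending `Q` to the quadratic data of the white product of `P` and `Q`. -/
def whiteDataFunctor {K : Type u} [Field K] (P : SymOperad K) : SymOperad K ⥤ QuadData K where
  obj Q := whiteData P Q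
  map φ := whiteMap P φ
  map_id _ := QuadData.Hom.ext TensorProduct.map_id
  map_comp _ _ := QuadData.Hom.ext (TensorProduct.ext' fun _ _ => rfl)

/-- The functor `P ∘ -`, the Manin white product with the operad `P`. -/
def whiteProduct {K : Type u} [Field K] (P : Op K) : Op K ⥤ Op K :=
  ObjectProperty.lift _
    (ObjectProperty.ι _ ⋙ whiteDataFunctor P.obj ⋙ QuadData.operadFunctor K)
    (fun Q => by
      have := P.finite_binary
      have := Q.finite_binary
      exact @isBinaryQuadratic_operad _ _ (whiteData P.obj Q.obj)
        (inferInstanceAs (Module.Finite K (P.obj.obj (Fin 2) ⊗[K] Q.obj.obj (Fin 2)))))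

/-- The generating operation `p ⊗ q` of the white product. -/
def whiteGen {K : Type u} [Field K] (P Q : Op K) (p : P.obj.obj (Fin 2))
    (q : Q.obj.obj (Fin 2)) : ((whiteProduct P).obj Q).obj.obj (Fin 2) :=
  (whiteData P.obj Q.obj).gen (p ⊗ₜ[K] q)

/-! ## Relative cochains on the one-simplex and the functor `Perm_∘` -/

/-- A local dg algebra with binary operations labelled by `E`: a complex `(X, d)`, graded by
`piece`, with operations of degree zero which satisfy the Leibniz rule and are compatible, with
the Koszul sign, with `e ↦ e^op`, and a subcomplex `bdry` which is an ideal. -/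
structure LocalDgAlg (K : Type u) [Field K] (E : Type u) [AddCommGroup E] [Module K E]
    (swap : E →ₗ[K] E) where
  X : Type u
  [grp : AddCommGroup X]
  [mod : Module K X]
  piece : ℕ → Submodule K X
  isInternal : DirectSum.IsInternal piece
  d : X →ₗ[K] X
  d_mem : ∀ n, ∀ x ∈ piece n, d x ∈ piece (n + 1)
  d_d : ∀ x, d (d x) = 0
  op : E →ₗ[K] X →ₗ[K] X →ₗ[K] X
  op_mem : ∀ e m n, ∀ x ∈ piece m, ∀ y ∈ piece n, op e x y ∈ piece (m + n)
  leibniz : ∀ e n, ∀ x ∈ piece n, ∀ y, d (op e x y) = op e (d x) y + (-1 : K) ^ n • op e x (d y)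
  op_swap : ∀ e m n, ∀ x ∈ piece m, ∀ y ∈ piece n,
    op (swap e) x y = (-1 : K) ^ (m * n) • op e y x
  bdry : Submodule K X
  d_bdry : ∀ x ∈ bdry, d x ∈ bdry
  op_bdry_left : ∀ e, ∀ x ∈ bdry, ∀ y, op e x y ∈ bdry
  op_bdry_right : ∀ e x, ∀ y ∈ bdry, op e x y ∈ bdry

attribute [instance] LocalDgAlg.grp LocalDgAlg.mod

/-- The Koszul sign of the permutation `x₀ x₁ x₂ ↦ x_{σ 0} x_{σ 1} x_{σ 2}` of elements of
degrees `n 0, n 1, n 2`. -/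
def koszulSign (K : Type u) [Field K] (σ : Equiv.Perm (Fin 3)) (n : Fin 3 → ℕ) : K :=
  ∏ a : Fin 3, ∏ b : Fin 3, if a < b ∧ σ b < σ a then (-1) ^ (n (σ a) * n (σ b)) else 1

/-- A relator vanishes in a dg algebra. -/
def LocalDgAlg.Satisfies {K : Type u} [Field K] {E : Type u} [AddCommGroup E] [Module K E]
    {swap : E →ₗ[K] E} (A : LocalDgAlg K E swap) (r : E × E × Equiv.Perm (Fin 3) →₀ K) : Prop :=
  ∀ (n : Fin 3 → ℕ) (x : Fin 3 → A.X), (∀ i, x i ∈ A.piece (n i)) →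
    Finsupp.linearCombination K (fun w => koszulSign K w.2.2 n •
      A.op w.1 (A.op w.2.1 (x (w.2.2 0)) (x (w.2.2 1))) (x (w.2.2 2))) r = 0

section cochains

variable (K : Type u) [Field K] (V : Type u) [AddCommGroup V] [Module K V]

/-- The cochains on the one-simplex with values in `V` which vanish on the simplices in `S`. The
nondegenerate simplices are the nonempty subsets of `{0, 1}`, where `0` is the left vertex. -/
def relCochains (S : Set (Finset (Fin 2))) : Submodule K (Finset (Fin 2) → V) where
  carrier := {f | f ∅ = 0 ∧ ∀ s ∈ S, f s = 0}
  zero_mem' := ⟨rfl, fun _ _ => rfl⟩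
  add_mem' hf hg := ⟨by simp [hf.1, hg.1], fun s hs => by simp [hf.2 s hs, hg.2 s hs]⟩
  smul_mem' c f hf := ⟨by simp [hf.1], fun s hs => by simp [hf.2 s hs]⟩

/-- The relative cochains `C^*(Δ₁, v_l; V)`. -/
abbrev Cochains := relCochains K V {{0}}

variable {K V}

lemma cochain_ext {f g : Cochains K V} (h1 : f.1 {1} = g.1 {1}) (h01 : f.1 {0, 1} = g.1 {0, 1}) :
    f = g := by
  apply Subtype.ext
  funext s
  have hs : s = ∅ ∨ s = {0} ∨ s = {1} ∨ s = {0, 1} := by revert s; decide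
  rcases hs with rfl | rfl | rfl | rfl
  · rw [f.2.1, g.2.1]
  · rw [f.2.2 _ rfl, g.2.2 _ rfl]
  · exact h1
  · exact h01

/-- The front face `s ∩ {0, …, v}`. -/
abbrev front (s : Finset (Fin 2)) (v : Fin 2) : Finset (Fin 2) := s.filter (· ≤ v)

/-- The back face `s ∩ {v, …}`. -/
abbrev back (s : Finset (Fin 2)) (v : Fin 2) : Finset (Fin 2) := s.filter (v ≤ ·)

/-- The value on `s` of the cup product of two cochains along a product `m` on `V`. -/
def cupFun (m : V →ₗ[K] V →ₗ[K] V) (f g : Finset (Fin 2) → V) (s : Finset (Fin 2)) : V :=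
  ∑ v ∈ s, m (f (front s v)) (g (back s v))

/-- The opposite cup product `(-1)^{|f||g|} g ∪ f`. -/
def cupOpFun (m : V →ₗ[K] V →ₗ[K] V) (f g : Finset (Fin 2) → V) (s : Finset (Fin 2)) : V :=
  ∑ v ∈ s, (-1 : K) ^ (((back s v).card - 1) * ((front s v).card - 1)) •
    m (g (front s v)) (f (back s v))

/-- The differential of cochains. -/
def dFun (f : Finset (Fin 2) → V) (s : Finset (Fin 2)) : V :=
  ∑ v ∈ s, (-1 : K) ^ (s.filter (· < v)).card • f (s.erase v)

lemma front_zero : front {0, 1} 0 = {0} := by decide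
lemma front_one : front {0, 1} 1 = {0, 1} := by decide
lemma back_zero : back {0, 1} 0 = {0, 1} := by decide
lemma back_one : back {0, 1} 1 = {1} := by decide
lemma front_self (v : Fin 2) : front {v} v = {v} := by revert v; decide
lemma back_self (v : Fin 2) : back {v} v = {v} := by revert v; decide

lemma cupFun_vertex (m : V →ₗ[K] V →ₗ[K] V) (f g : Finset (Fin 2) → V) (v : Fin 2) :
    cupFun m f g {v} = m (f {v}) (g {v}) := by
  simp only [cupFun, Finset.sum_singleton, front_self, back_self]

lemma cupFun_edge (m : V →ₗ[K] V →ₗ[K] V) (f g : Finset (Fin 2) → V) :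
    cupFun m f g {0, 1} = m (f {0}) (g {0, 1}) + m (f {0, 1}) (g {1}) := by
  rw [cupFun, Finset.sum_pair (by decide), front_zero, front_one, back_zero, back_one]

lemma cupOpFun_vertex (m : V →ₗ[K] V →ₗ[K] V) (f g : Finset (Fin 2) → V) (v : Fin 2) :
    cupOpFun m f g {v} = m (g {v}) (f {v}) := by
  simp only [cupOpFun, Finset.sum_singleton, front_self, back_self]
  simp

lemma cupOpFun_edge (m : V →ₗ[K] V →ₗ[K] V) (f g : Finset (Fin 2) → V) :
    cupOpFun m f g {0, 1} = m (g {0}) (f {0, 1}) + m (g {0, 1}) (f {1}) := by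
  rw [cupOpFun, Finset.sum_pair (by decide), front_zero, front_one, back_zero, back_one]
  simp

lemma dFun_vertex (f : Finset (Fin 2) → V) (v : Fin 2) : dFun (K := K) f {v} = f ∅ := by
  simp [dFun, Finset.filter_singleton]

lemma dFun_edge (f : Finset (Fin 2) → V) :
    dFun (K := K) f {0, 1} = f {1} - f {0} := by
  rw [dFun, Finset.sum_pair (by decide),
    show ({0, 1} : Finset (Fin 2)).filter (· < 0) = ∅ by decide,
    show ({0, 1} : Finset (Fin 2)).filter (· < 1) = {0} by decide,
    show ({0, 1} : Finset (Fin 2)).erase 0 = {1} by decide,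
    show ({0, 1} : Finset (Fin 2)).erase 1 = {0} by decide]
  simp [sub_eq_add_neg]

lemma cochain_left (f : Cochains K V) : f.1 {0} = 0 := f.2.2 _ rfl

lemma cochain_mem_of {f : Finset (Fin 2) → V} (h : f ∅ = 0) (h0 : f {0} = 0) :
    f ∈ relCochains K V {{0}} := ⟨h, by rintro _ rfl; exact h0⟩

/-- The cup product on `C^*(Δ₁, v_l; V)` along a product on `V`. -/
def cup : (V →ₗ[K] V →ₗ[K] V) →ₗ[K] Cochains K V →ₗ[K] Cochains K V →ₗ[K] Cochains K V where
  toFun m := LinearMap.mk₂ K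
    (fun f g => ⟨cupFun m f.1 g.1, cochain_mem_of (by simp [cupFun])
      (by rw [cupFun_vertex, cochain_left f]; simp)⟩)
    (fun f f' g => cochain_ext (by simp [cupFun_vertex])
      (by simp [cupFun_edge]; abel))
    (fun c f g => cochain_ext (by simp [cupFun_vertex]) (by simp [cupFun_edge]))
    (fun f g g' => cochain_ext (by simp [cupFun_vertex])
      (by simp [cupFun_edge]; abel))
    (fun c f g => cochain_ext (by simp [cupFun_vertex]) (by simp [cupFun_edge]))
  map_add' m m' := LinearMap.ext₂ fun f g => cochain_ext (by simp [cupFun_vertex])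
    (by simp [cupFun_edge]; abel)
  map_smul' c m := LinearMap.ext₂ fun f g => cochain_ext (by simp [cupFun_vertex])
    (by simp [cupFun_edge])

/-- The opposite cup product on `C^*(Δ₁, v_l; V)` along a product on `V`. -/
def cupOp : (V →ₗ[K] V →ₗ[K] V) →ₗ[K] Cochains K V →ₗ[K] Cochains K V →ₗ[K] Cochains K V where
  toFun m := LinearMap.mk₂ K
    (fun f g => ⟨cupOpFun m f.1 g.1, cochain_mem_of (by simp [cupOpFun])
      (by rw [cupOpFun_vertex, cochain_left f]; simp)⟩)
    (fun f f' g => cochain_ext (by simp [cupOpFun_vertex])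
      (by simp [cupOpFun_edge]; abel))
    (fun c f g => cochain_ext (by simp [cupOpFun_vertex]) (by simp [cupOpFun_edge]))
    (fun f g g' => cochain_ext (by simp [cupOpFun_vertex])
      (by simp [cupOpFun_edge]; abel))
    (fun c f g => cochain_ext (by simp [cupOpFun_vertex]) (by simp [cupOpFun_edge]))
  map_add' m m' := LinearMap.ext₂ fun f g => cochain_ext (by simp [cupOpFun_vertex])
    (by simp [cupOpFun_edge]; abel)
  map_smul' c m := LinearMap.ext₂ fun f g => cochain_ext (by simp [cupOpFun_vertex])
    (by simp [cupOpFun_edge])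

/-- The differential of `C^*(Δ₁, v_l; V)`. -/
def cochainD : Cochains K V →ₗ[K] Cochains K V where
  toFun f := ⟨dFun (K := K) f.1, cochain_mem_of (by simp [dFun])
    (by rw [dFun_vertex, f.2.1])⟩
  map_add' f g := cochain_ext (by simp [dFun_vertex]) (by simp [dFun_edge]; abel)
  map_smul' c f := cochain_ext (by simp [dFun_vertex]) (by simp [dFun_edge, smul_sub])

lemma cup_one (m : V →ₗ[K] V →ₗ[K] V) (f g : Cochains K V) :
    (cup m f g).1 {1} = m (f.1 {1}) (g.1 {1}) := cupFun_vertex ..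

lemma cup_edge (m : V →ₗ[K] V →ₗ[K] V) (f g : Cochains K V) :
    (cup m f g).1 {0, 1} = m (f.1 {0, 1}) (g.1 {1}) :=
  (cupFun_edge ..).trans (by simp [cochain_left f])

lemma cupOp_one (m : V →ₗ[K] V →ₗ[K] V) (f g : Cochains K V) :
    (cupOp m f g).1 {1} = m (g.1 {1}) (f.1 {1}) := cupOpFun_vertex ..

lemma cupOp_edge (m : V →ₗ[K] V →ₗ[K] V) (f g : Cochains K V) :
    (cupOp m f g).1 {0, 1} = m (g.1 {0, 1}) (f.1 {1}) :=
  (cupOpFun_edge ..).trans (by simp [cochain_left g])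

lemma cochainD_one (f : Cochains K V) : (cochainD f).1 {1} = 0 :=
  (dFun_vertex ..).trans f.2.1

lemma cochainD_edge (f : Cochains K V) : (cochainD f).1 {0, 1} = f.1 {1} :=
  (dFun_edge ..).trans (by simp [cochain_left f])

/-- The cochains of degree `n`: those supported on the `n`-simplices. -/
def cochainPiece (K : Type u) [Field K] (V : Type u) [AddCommGroup V] [Module K V] (n : ℕ) :
    Submodule K (Cochains K V) where
  carrier := {f | ∀ s, s.card ≠ n + 1 → f.1 s = 0}
  zero_mem' _ _ := rfl
  add_mem' hf hg s hs := by simp [hf s hs, hg s hs]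
  smul_mem' c f hf s hs := by simp [hf s hs]

lemma mem_cochainPiece_iff (n : ℕ) (f : Cochains K V) :
    f ∈ cochainPiece K V n ↔ (n ≠ 0 → f.1 {1} = 0) ∧ (n ≠ 1 → f.1 {0, 1} = 0) := by
  constructor
  · intro h
    exact ⟨fun hn => h _ (by simp; omega), fun hn => h _ (by rw [Finset.card_pair (by decide)]; omega)⟩
  · rintro ⟨h1, h2⟩ s hs
    have hs' : s = ∅ ∨ s = {0} ∨ s = {1} ∨ s = {0, 1} := by clear hs; revert s; decide
    rcases hs' with rfl | rfl | rfl | rfl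
    · exact f.2.1
    · exact cochain_left f
    · exact h1 (by simp at hs; omega)
    · exact h2 (by rw [Finset.card_pair (by decide)] at hs; omega)

lemma cochainPiece_isInternal : DirectSum.IsInternal (cochainPiece K V) := by
  rw [DirectSum.isInternal_submodule_iff_iSupIndep_and_iSup_eq_top]
  constructor
  · intro i
    rw [Submodule.disjoint_def]
    intro f hf hf'
    let N : Submodule K (Cochains K V) :=
      { carrier := {f | ∀ s, s.card = i + 1 → f.1 s = 0}
        zero_mem' := fun _ _ => rfl
        add_mem' := fun hf hg s hs => by simp [hf s hs, hg s hs]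
        smul_mem' := fun c f hf s hs => by simp [hf s hs] }
    have hN : f ∈ N := by
      refine (iSup₂_le (a := N) fun j hj g hg s hs => ?_) hf'
      exact hg s (by omega)
    apply Subtype.ext
    funext s
    by_cases hs : s.card = i + 1
    · exact hN s hs
    · exact hf s hs
  · rw [eq_top_iff]
    intro f _
    let f0 : Cochains K V := ⟨fun s => if s.card = 1 then f.1 s else 0,
      cochain_mem_of (by simp) (by simp [cochain_left f])⟩
    let f1 : Cochains K V := ⟨fun s => if s.card = 1 then 0 else f.1 s,
      cochain_mem_of (by simp [f.2.1]) (by simp)⟩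
    have hf : f = f0 + f1 := by
      apply Subtype.ext
      funext s
      by_cases hs : s.card = 1 <;> simp [f0, f1, hs]
    rw [hf]
    refine add_mem (Submodule.mem_iSup_of_mem 0 ?_) (Submodule.mem_iSup_of_mem 1 ?_)
    · exact (mem_cochainPiece_iff _ _).2 ⟨by simp, fun _ => by simp [f0]⟩
    · exact (mem_cochainPiece_iff _ _).2 ⟨fun _ => by simp [f1], by simp⟩

/-- The cochains vanishing on the boundary of the one-simplex. -/
def cochainBdry (K : Type u) [Field K] (V : Type u) [AddCommGroup V] [Module K V] :
    Submodule K (Cochains K V) :=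
  (relCochains K V {{0}, {1}}).comap (Submodule.subtype _)

lemma mem_cochainBdry_iff (f : Cochains K V) : f ∈ cochainBdry K V ↔ f.1 {1} = 0 := by
  constructor
  · intro h
    exact h.2 _ (by simp)
  · intro h
    refine ⟨f.2.1, ?_⟩
    rintro _ (rfl | rfl)
    · exact cochain_left f
    · exact h

end cochains

/-- For an algebra `V` over an operad `O`, the complex `C^*(Δ₁, v_l; V)` with the cup products:
the pair `(o, o')` of binary operations of `O` acts as the sum of the cup product along `o` and of
the opposite of the cup product along `o'`. -/
abbrev cochainAlg {K : Type u} [Field K] {O : SymOperad K} (A : O.Alg) :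
    LocalDgAlg K (O.obj (Fin 2) × O.obj (Fin 2)) (LinearEquiv.prodComm K _ _).toLinearMap where
  X := Cochains K A.V
  piece := cochainPiece K A.V
  isInternal := cochainPiece_isInternal
  d := cochainD
  d_mem n f hf := by
    rw [mem_cochainPiece_iff] at *
    refine ⟨fun _ => cochainD_one f, fun hn => ?_⟩
    rw [cochainD_edge]
    exact hf.1 (by omega)
  d_d f := cochain_ext (cochainD_one _) ((cochainD_edge _).trans (cochainD_one f))
  op := LinearMap.coprod (cup ∘ₗ A.prod) (cupOp ∘ₗ A.prod)
  op_mem e m n f hf g hg := by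
    rw [mem_cochainPiece_iff] at *
    constructor
    · intro h
      rcases Nat.eq_zero_or_pos m with hm | hm
      · simp [cup_one, cupOp_one, hg.1 (by omega)]
      · simp [cup_one, cupOp_one, hf.1 (by omega)]
    · intro h
      by_cases hm : m = 0
      · simp [cup_edge, cupOp_edge, hf.2 (by omega), hg.2 (by omega)]
      · by_cases hn : n = 0
        · simp [cup_edge, cupOp_edge, hf.2 (by omega), hg.2 (by omega)]
        · simp [cup_edge, cupOp_edge, hf.1 (by omega), hg.1 (by omega)]
  leibniz e n f hf g := by
    rw [mem_cochainPiece_iff] at hf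
    apply cochain_ext
    · simp [cup_one, cupOp_one, cochainD_one]
    · by_cases hn : n = 0
      · subst hn
        simp [cup_one, cupOp_one, cup_edge, cupOp_edge, cochainD_one, cochainD_edge]
      · simp [cup_one, cupOp_one, cup_edge, cupOp_edge, cochainD_one, cochainD_edge, hf.1 hn]
  op_swap e m n f hf g hg := by
    rw [mem_cochainPiece_iff] at *
    apply cochain_ext
    · by_cases hm : m = 0
      · subst hm
        simp [cup_one, cupOp_one, add_comm]
      · simp [cup_one, cupOp_one, hf.1 hm]
    · by_cases hm : m = 0
      · subst hm
        simp [cup_edge, cupOp_edge, add_comm]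
      · by_cases hn : n = 0
        · subst hn
          simp [cup_edge, cupOp_edge, add_comm]
        · simp [cup_edge, cupOp_edge, hf.1 hm, hg.1 hn]
  bdry := cochainBdry K A.V
  d_bdry f hf := (mem_cochainBdry_iff _).2 (cochainD_one f)
  op_bdry_left e f hf g := by
    rw [mem_cochainBdry_iff] at *
    simp [cup_one, cupOp_one, hf]
  op_bdry_right e f g hg := by
    rw [mem_cochainBdry_iff] at *
    simp [cup_one, cupOp_one, hg]

/-- The quadratic data of `Perm_∘(O)`: one nonsymmetric generating operation `∪ ⊗ o = (o, 0)`, with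
opposite `(0, o)`, for every `o ∈ O(2)` (linearly in `o`), and as relators all those that vanish
in `C^*(Δ₁, v_l; V)` with the cup products, for every `O`-algebra `V`. If `O(2)` has a basis formed
by products `·ᵢ` and their opposites, commutative products `•ⱼ` and anticommutative brackets
`[-,-]ₖ`, the nonsymmetric generators are `∪ ⊗ ·ᵢ`, `∪ ⊗ ·ᵢ^op`, `∪ ⊗ •ⱼ` and `∪ ⊗ [-,-]ₖ`. -/
abbrev permCircData {K : Type u} [Field K] (O : SymOperad K) : QuadData K where
  E := O.obj (Fin 2) × O.obj (Fin 2)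
  swap := (LinearEquiv.prodComm K _ _).toLinearMap
  swap_swap _ := rfl
  rel := {r | ∀ A : O.Alg, (cochainAlg A).Satisfies r}

/-- Functoriality of `Perm_∘`. -/
def permCircMap {K : Type u} [Field K] {O O' : SymOperad K} (φ : SymOperad.Hom O O') :
    permCircData O ⟶ permCircData O' where
  map := LinearMap.prodMap (φ.app (Fin 2)) (φ.app (Fin 2))
  map_swap _ := rfl
  map_rel r hr := by
    intro A n x hx
    have h := hr (A.restrict φ) n x hx
    exact (linearCombination_relMap _ _ r).trans h

/-- The functor sending `O` to the quadratic data of `Perm_∘(O)`. -/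
def permCircDataFunctor (K : Type u) [Field K] : SymOperad K ⥤ QuadData K where
  obj O := permCircData O
  map φ := permCircMap φ
  map_id _ := rfl
  map_comp _ _ := rfl

/-- The functor `Perm_∘(-)`. -/
def permCirc (K : Type u) [Field K] : Op K ⥤ Op K :=
  ObjectProperty.lift _
    (ObjectProperty.ι _ ⋙ permCircDataFunctor K ⋙ QuadData.operadFunctor K)
    (fun O => by
      have := O.finite_binary
      exact @isBinaryQuadratic_operad _ _ (permCircData O.obj)
        (inferInstanceAs (Module.Finite K (O.obj.obj (Fin 2) × O.obj.obj (Fin 2)))))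

/-- The generating operation `∪ ⊗ o` of `Perm_∘(O)`. -/
def cupGen {K : Type u} [Field K] (O : Op K) (o : O.obj.obj (Fin 2)) :
    ((permCirc K).obj O).obj.obj (Fin 2) :=
  (permCircData O.obj).gen ((o, 0) : O.obj.obj (Fin 2) × O.obj.obj (Fin 2))

end ManinProduct

end

open ManinProduct

/-! Write a cochain in $C^*(\Delta_1,v_l;\mathbb K)$ as a combination of $t$, supported at the right
vertex, and $dt$, supported on the edge. Vanishing at the left vertex kills one term of the cup
product on the edge, and what remains is $xy=\varepsilon(y)x$ with $\varepsilon(t)=1$,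
$\varepsilon(dt)=0$. This is a right permutative algebra (`augProd_isAlg`), and it is rich enough to
see all of $\mathcal Perm(3)$.

A ternary permutative monomial depends only on its first variable, so $\mathcal Perm(3)$ has three
spanning monomials. The $i$-th coefficient is read off by putting $dt$ in position $i$ and $t$
elsewhere, and the three coefficients determine the operation (`sum_multilinCoeff_smul`). Hence an
element of $\mathcal Perm(3)\otimes\mathcal O(3)$ is determined by three coefficients in $\mathcal
O(3)$ (`eq_zero_of_tensorCoeff`).

The generators are matched by `permTensor`. A relator then has a value in $\mathcal
Perm(3)\otimes\mathcal O(3)$, with coefficients `relCoeff`. The same coefficients govern its value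
on cochains: on the edge, the $i$-th one is applied to the edge value of the $i$-th argument and the
vertex values of the others (`quadEval_edge`); at the vertex, all three are applied to the vertex
values (`quadEval_one`). Koszul signs play no role: in total degree at least two everything
vanishes, and in total degree at most one all signs are $1$ (`satisfies_iff_quadEval`). Choosing a
single argument of degree one isolates each coefficient, so a relator holds in the cochains with
values in $V$ exactly when its three coefficients act by zero on $V$ (`satisfies_iff_act`).

A binary quadratic operad acts faithfully on its free algebras (`Op.eq_zero_of_act`). Therefore
holding for all $V$ means that the coefficients vanish, that is, that the relator lies in the kernel
defining the white product (`mem_permCircData_rel_iff`). The two quadratic data are thus isomorphic,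
naturally in $\mathcal O$. -/

noncomputable section
namespace ManinProduct

/-! ### Coefficient functionals on the permutative operad. -/

section Perm

variable (K : Type u) [Field K]

/-- The products on `K × K`, seen as the span of `t = (1, 0)` and `dt = (0, 1)`, with
`x y = ε(y) x` for the augmentation `ε(t) = 1`, `ε(dt) = 0`. -/
def augProd : (permData K).E →ₗ[K] (K × K) →ₗ[K] (K × K) →ₗ[K] (K × K) :=
  LinearMap.coprod
    (LinearMap.toSpanSingleton K _ (LinearMap.lsmul K (K × K) ∘ₗ LinearMap.fst K K K).flip)
    (LinearMap.toSpanSingleton K _ (LinearMap.lsmul K (K × K) ∘ₗ LinearMap.fst K K K))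

variable {K}

/-- The function underlying `augProd`. -/
def augFun (e x y : K × K) : K × K := e.1 • y.1 • x + e.2 • x.1 • y

/-- The augmentation is multiplicative, so $(xy)z$, $x(yz)$ and $x(zy)$ are all
$\varepsilon(y)\varepsilon(z)x$. -/
lemma augProd_isAlg : (permData K).IsAlg (augProd K) where
  swap e x y := add_comm _ _
  rel r hr v := by
    change quadEval (E := K × K) augFun v r = 0
    rcases hr with rfl | rfl <;>
    · rw [quadEval, map_sub, Finsupp.linearCombination_single, Finsupp.linearCombination_single]
      ext <;> simp [augFun] <;> ring

/-- The arguments `dt` in position `i` and `t` elsewhere. -/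
def augArg {ι : Type} [DecidableEq ι] (i j : ι) : K × K := if j = i then (0, 1) else (1, 0)

/-- The coefficient in a multilinear element of the free permutative algebra of the monomials
starting with the `i`-th variable. -/
def multilinCoeff {ι : Type} [DecidableEq ι] (i : ι) :
    (permData K).multilin (Set.univ : Set ι) →ₗ[K] K :=
  LinearMap.snd K K K ∘ₗ (permData K).lift augProd_isAlg (augArg i) ∘ₗ Submodule.subtype _

lemma multilinCoeff_apply {ι : Type} [DecidableEq ι] (i : ι)
    (p : (permData K).multilin (Set.univ : Set ι)) :
    multilinCoeff i p = ((permData K).lift augProd_isAlg (augArg i) p.1).2 := rfl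

lemma multilinCoeff_relabel {ι κ : Type} [DecidableEq ι] [DecidableEq κ] (e : ι ≃ κ) (i : ι)
    (p : (permData K).multilin (Set.univ : Set ι)) :
    multilinCoeff (e i) ((permData K).relabelMap e p) = multilinCoeff i p := by
  rw [multilinCoeff_apply, QuadData.relabelMap_coe, QuadData.lift_rename, multilinCoeff_apply]
  congr 3
  funext j
  simp [augArg]

/-- The product $xy=\varepsilon(y)x$ keeps its first factor and scales it by the augmentations of
the rest. With $dt$ in position $i$ and $t$ elsewhere, a permutative monomial therefore evaluates to
$dt$ if it starts with the $i$-th variable, and otherwise to $0$. -/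
lemma multilinCoeff_mon {ι : Type} [DecidableEq ι] (i : ι) (t : QuadData.Term (K × K) ι)
    (ht : (permData K).mon t ∈ (permData K).multilin (Set.univ : Set ι)) :
    multilinCoeff i ⟨(permData K).mon t, ht⟩ = (t.eval augFun (augArg i)).2 :=
  congrArg Prod.snd ((permData K).lift_mon augProd_isAlg _ t)

lemma multilinCoeff_gen_zero (e : K × K) : multilinCoeff 0 ((permData K).gen e) = e.1 := by
  refine (multilinCoeff_mon 0 _ _).trans ?_
  simp [QuadData.Term.eval, augFun, augArg]

lemma multilinCoeff_gen_one (e : K × K) : multilinCoeff 1 ((permData K).gen e) = e.2 := by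
  refine (multilinCoeff_mon 1 _ _).trans ?_
  simp [QuadData.Term.eval, augFun, augArg]

/-- Composition in `D.operad` is substitution followed by renaming. Carrying both out on monomials
leaves a concrete term on which `lift` can be evaluated. -/
lemma leftComb_coe (D : QuadData K) (e f : D.E) :
    (D.operad.leftComb (D.gen e) (D.gen f)).1 =
      D.mon (.node e (.node f (.var 0) (.var 1)) (.var 2)) := by
  refine (congrArg (D.rename _) (D.lift_mon (D.op_isAlg _) _ _)).trans ?_
  simp only [QuadData.Term.eval]
  rw [QuadData.rename, QuadData.lift_op, QuadData.mon_node, QuadData.mon_node]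
  congr 1
  · congr 1
    refine (D.lift_lift (D.op_isAlg _) _ _ _).trans ?_
    refine (D.lift_mon (D.op_isAlg _) _ _).trans ?_
    simp only [QuadData.Term.eval, QuadData.lift_var]
    rfl
  · refine (D.lift_lift (D.op_isAlg _) _ _ _).trans ?_
    refine (D.lift_mon (D.op_isAlg _) _ _).trans ?_
    simp only [QuadData.Term.eval, QuadData.lift_var]
    rfl

/-- Expanding $e(f(x_0,x_1),x_2)$, the part $e_1$ gives monomials starting with $x_0$ or $x_1$
according to $f$. The part $e_2$ puts $x_2$ first, where the order of the other two variables is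
immaterial; hence the sum $f_1+f_2$. -/
lemma multilinCoeff_leftComb (i : Fin 3) (e f : K × K) :
    multilinCoeff i ((permData K).operad.leftComb ((permData K).gen e) ((permData K).gen f)) =
      ![e.1 * f.1, e.1 * f.2, e.2 * (f.1 + f.2)] i := by
  refine (congrArg (fun x => ((permData K).lift augProd_isAlg (augArg i) x).2)
    (leftComb_coe (permData K) e f)).trans ?_
  refine (congrArg Prod.snd ((permData K).lift_mon augProd_isAlg _ _)).trans ?_
  change (QuadData.Term.eval (E := K × K) augFun _ _).2 = _
  fin_cases i <;> simp [QuadData.Term.eval, augFun, augArg, mul_add]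

/-! ### The arity three part of the permutative operad. -/

/-- The product `x y` of the free permutative algebra. -/
def permStar (ι : Type) : (permData K).FreeAlg ι →ₗ[K] (permData K).FreeAlg ι →ₗ[K]
    (permData K).FreeAlg ι :=
  (permData K).op ι ((1, 0) : K × K)

lemma permData_op_swap (ι : Type) (x y : (permData K).FreeAlg ι) :
    (permData K).op ι ((0, 1) : K × K) x y = permStar ι y x :=
  ((permData K).op_isAlg ι).swap ((1, 0) : K × K) x y

lemma permData_op (ι : Type) (e : K × K) (x y : (permData K).FreeAlg ι) :
    (permData K).op ι e x y = e.1 • permStar ι x y + e.2 • permStar ι y x := by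
  have he : (permData K).op ι e = e.1 • (permData K).op ι ((1, 0) : K × K) +
      e.2 • (permData K).op ι ((0, 1) : K × K) := by
    refine Eq.trans (congrArg ((permData K).op ι) (?_ : e = e.1 • ((1, 0) : K × K) +
      e.2 • ((0, 1) : K × K))) ?_
    · ext <;> simp
    · exact (((permData K).op ι).map_add _ _).trans (congrArg₂ _
        (((permData K).op ι).map_smul _ _) (((permData K).op ι).map_smul _ _))
  rw [he, ← permData_op_swap ι x y]
  rfl

lemma permStar_assoc (ι : Type) (x y z : (permData K).FreeAlg ι) :
    permStar ι (permStar ι x y) z = permStar ι x (permStar ι y z) := by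
  have h := ((permData K).op_isAlg ι).rel _ (Or.inl rfl) ![x, y, z]
  rw [quadEval, map_sub, Finsupp.linearCombination_single, Finsupp.linearCombination_single,
    one_smul, one_smul, sub_eq_zero] at h
  exact h.trans (permData_op_swap _ _ _)

lemma permStar_perm (ι : Type) (x y z : (permData K).FreeAlg ι) :
    permStar ι x (permStar ι y z) = permStar ι x (permStar ι z y) := by
  have h := ((permData K).op_isAlg ι).rel _ (Or.inr rfl) ![x, y, z]
  rw [quadEval, map_sub, Finsupp.linearCombination_single, Finsupp.linearCombination_single,
    one_smul, one_smul, sub_eq_zero] at h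
  exact (permData_op_swap _ _ _).symm.trans
    (h.trans ((permData_op_swap _ _ _).trans (congrArg _ (permData_op_swap _ _ _))))

/-- The ternary permutative operation `(xᵢ xᵢ₊₁) xᵢ₊₂`. -/
def permMon (i : Fin 3) : (permData K).multilin (Set.univ : Set (Fin 3)) :=
  ⟨(permData K).mon (.node ((1, 0) : K × K) (.node ((1, 0) : K × K) (.var i) (.var (i + 1)))
    (.var (i + 2))), Submodule.subset_span ⟨_, by
      revert i; simp only [QuadData.Term.vars]; decide, by
      revert i; simp only [QuadData.Term.vars, Set.mem_univ]; decide, rfl⟩⟩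

lemma permMon_coe (i : Fin 3) : (permMon (K := K) i).1 =
    permStar _ (permStar _ ((permData K).mon (.var i)) ((permData K).mon (.var (i + 1))))
      ((permData K).mon (.var (i + 2))) :=
  ((permData K).mon_node _ _ _).trans
    (congrArg (fun x => permStar _ x _) ((permData K).mon_node _ _ _))

lemma multilinCoeff_permMon (i j : Fin 3) :
    multilinCoeff i (permMon (K := K) j) = if i = j then 1 else 0 := by
  refine (multilinCoeff_mon i _ _).trans ?_
  fin_cases i <;> fin_cases j <;> simp [QuadData.Term.eval, augFun, augArg]

/-- Both operations expand into $\mu$ and $\mu^{op}$, which leaves four permutative monomials. Each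
of them equals the chosen one with the same first variable. -/
lemma op_op_var_mem_span (i j k : Fin 3) (h : [i, j, k].Nodup) (e f : K × K) :
    (permData K).op (Fin 3) e ((permData K).op (Fin 3) f ((permData K).mon (.var i))
      ((permData K).mon (.var j))) ((permData K).mon (.var k)) ∈
    Submodule.span K (Set.range fun i => (permMon (K := K) i).1) := by
  have key : ∀ i j k : Fin 3, [i, j, k].Nodup →
      permStar _ (permStar _ ((permData K).mon (.var i)) ((permData K).mon (.var j)))
        ((permData K).mon (.var k)) ∈
      Submodule.span K (Set.range fun i => (permMon (K := K) i).1) := by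
    intro i j k h
    -- `permMon i` lists the variables cyclically from $i$, so $j,k$ are in cyclic order or in the
    -- reverse one.
    have h' : (j = i + 1 ∧ k = i + 2) ∨ (k = i + 1 ∧ j = i + 2) := by
      revert h; revert i j k; decide
    refine Submodule.subset_span ⟨i, ?_⟩
    rcases h' with ⟨rfl, rfl⟩ | ⟨rfl, rfl⟩
    · exact permMon_coe i
    -- $(xy)z=x(yz)=x(zy)=(xz)y$ restores the cyclic order.
    · rw [permStar_assoc, permStar_perm, ← permStar_assoc]
      exact permMon_coe i
  have h2 : [j, i, k].Nodup := by revert h; revert i j k; decide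
  have h3 : [k, i, j].Nodup := by revert h; revert i j k; decide
  have h4 : [k, j, i].Nodup := by revert h; revert i j k; decide
  rw [permData_op _ e, permData_op _ f]
  simp only [map_add, map_smul, LinearMap.add_apply, LinearMap.smul_apply, ← permStar_assoc]
  exact add_mem
    (Submodule.smul_mem _ _ (add_mem (Submodule.smul_mem _ _ (key _ _ _ h))
      (Submodule.smul_mem _ _ (key _ _ _ h2))))
    (Submodule.smul_mem _ _ (add_mem (Submodule.smul_mem _ _ (key _ _ _ h3))
      (Submodule.smul_mem _ _ (key _ _ _ h4))))

lemma eq_node_of_length {E : Type u} {ι : Type} (t : QuadData.Term E ι) (h : t.vars.length = 2) :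
    ∃ e i j, t = .node e (.var i) (.var j) := by
  cases t with
  | var i => simp [QuadData.Term.vars] at h
  | node e s t =>
    have h1 := List.length_pos_iff.2 (QuadData.vars_ne_nil s)
    have h2 := List.length_pos_iff.2 (QuadData.vars_ne_nil t)
    simp only [QuadData.Term.vars, List.length_append] at h
    obtain ⟨i, rfl⟩ := QuadData.eq_var_of_length s (by omega)
    obtain ⟨j, rfl⟩ := QuadData.eq_var_of_length t (by omega)
    exact ⟨e, i, j, rfl⟩

lemma mem_span_permMon (p : (permData K).multilin (Set.univ : Set (Fin 3))) :
    p.1 ∈ Submodule.span K (Set.range fun i => (permMon (K := K) i).1) := by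
  obtain ⟨p, hp⟩ := p
  refine Submodule.span_le.2 ?_ hp
  rintro _ ⟨t, ht, htX, rfl⟩
  have hlen : t.vars.length = 3 := by
    rw [← List.toFinset_card_of_nodup ht,
      show t.vars.toFinset = Finset.univ by ext i; simp [htX]]
    rfl
  cases t with
  | var i => simp [QuadData.Term.vars] at hlen
  | node e s t =>
    have h1 := List.length_pos_iff.2 (QuadData.vars_ne_nil s)
    have h2 := List.length_pos_iff.2 (QuadData.vars_ne_nil t)
    simp only [QuadData.Term.vars, List.length_append] at hlen
    -- A ternary binary tree has the shape $(ij)k$ or $k(ij)$; the second becomes the first when its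
    -- root label is replaced by the opposite.
    rcases (by omega : s.vars.length = 2 ∧ t.vars.length = 1 ∨
      s.vars.length = 1 ∧ t.vars.length = 2) with ⟨hs, h⟩ | ⟨h, hs⟩
    · obtain ⟨f, i, j, rfl⟩ := eq_node_of_length s hs
      obtain ⟨k, rfl⟩ := QuadData.eq_var_of_length t h.le
      rw [SetLike.mem_coe, QuadData.mon_node, QuadData.mon_node]
      exact op_op_var_mem_span i j k ht e f
    · obtain ⟨f, i, j, rfl⟩ := eq_node_of_length t hs
      obtain ⟨k, rfl⟩ := QuadData.eq_var_of_length s h.le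
      rw [SetLike.mem_coe, QuadData.mon_node, QuadData.mon_node,
        ← ((permData K).op_isAlg (Fin 3)).swap]
      have ht' : [k, i, j].Nodup := ht
      exact op_op_var_mem_span i j k (by revert ht'; clear * -; revert i j k; decide) _ f

/-- The monomials `permMon i` span, and `multilinCoeff_permMon` makes the coefficient functionals
dual to them. The identity thus holds on a spanning set. -/
lemma sum_multilinCoeff_smul (p : (permData K).multilin (Set.univ : Set (Fin 3))) :
    ∑ i, multilinCoeff i p • permMon i = p := by
  have h : p ∈ Submodule.span K (Set.range (permMon (K := K))) := by
    -- This span is formed in the ambient free algebra; injectivity of the inclusion brings it back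
    -- to the multilinear part.
    have h := mem_span_permMon p
    rw [show (Set.range fun i => (permMon (K := K) i).1) =
        ((permData K).multilin (Set.univ : Set (Fin 3))).subtype '' Set.range permMon by
      rw [← Set.range_comp]; rfl, ← Submodule.map_span] at h
    obtain ⟨q, hq, hqp⟩ := h
    rwa [← Subtype.ext hqp]
  induction h using Submodule.span_induction with
  | zero => simp
  | add x y _ _ hx hy => simp only [map_add, add_smul, Finset.sum_add_distrib, hx, hy]
  | smul c x _ hx => simp only [map_smul, smul_assoc, ← Finset.smul_sum, hx]
  | mem x hx =>
    obtain ⟨j, rfl⟩ := hx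
    simp [multilinCoeff_permMon]

/-- The binary operation `a x y + b y x` of the permutative operad. -/
def permGen : K × K →ₗ[K] (permOp K).obj.obj (Fin 2) := (permData K).gen

/-- The coefficient in a permutative operation of the monomials starting with the `i`-th
variable. -/
def permCoeff {ι : Type} [Finite ι] [DecidableEq ι] (i : ι) : (permOp K).obj.obj ι →ₗ[K] K :=
  multilinCoeff i

lemma permCoeff_relabel {ι κ : Type} [Finite ι] [Finite κ] [DecidableEq ι] [DecidableEq κ]
    (e : ι ≃ κ) (i : ι) (p : (permOp K).obj.obj ι) :
    permCoeff (e i) ((permOp K).obj.relabel e p) = permCoeff i p :=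
  multilinCoeff_relabel e i p

lemma permCoeff_permGen (i : Fin 2) (e : K × K) : permCoeff i (permGen e) = ![e.1, e.2] i := by
  fin_cases i
  · exact multilinCoeff_gen_zero e
  · exact multilinCoeff_gen_one e

lemma permGen_permCoeff (p : (permOp K).obj.obj (Fin 2)) :
    permGen (permCoeff 0 p, permCoeff 1 p) = p := by
  obtain ⟨e, rfl⟩ : ∃ e, permGen e = p := (permData K).gen_surjective p
  simp [permCoeff_permGen]

lemma swap_permGen (e : K × K) : (permOp K).obj.swap (permGen e) = permGen e.swap := by
  refine Subtype.ext (((permData K).lift_mon ((permData K).op_isAlg _) _ _).trans ?_)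
  exact (((permData K).op_isAlg (Fin 2)).swap _ _ _).symm.trans
    ((permData K).mon_node _ _ _).symm

lemma permCoeff_leftComb (i : Fin 3) (e f : K × K) :
    permCoeff i ((permOp K).obj.leftComb (permGen e) (permGen f)) =
      ![e.1 * f.1, e.1 * f.2, e.2 * (f.1 + f.2)] i :=
  multilinCoeff_leftComb i e f

/-- A ternary permutative operation is determined by its coefficients. -/
lemma exists_sum_permCoeff_smul (K : Type u) [Field K] :
    ∃ m : Fin 3 → (permOp K).obj.obj (Fin 3), ∀ p, ∑ i, permCoeff i p • m i = p :=
  ⟨permMon, sum_multilinCoeff_smul⟩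

end Perm

/-! ### Coefficients of the tensor product of the permutative operad with another operad. -/

section PermTensor

variable {K : Type u} [Field K]

/-- The map `Perm(ι) ⊗ M → M` given by the coefficient of the monomials starting with the `i`-th
variable. -/
def tensorCoeff {ι : Type} [Finite ι] [DecidableEq ι] (i : ι) (M : Type u) [AddCommGroup M]
    [Module K M] : (permOp K).obj.obj ι ⊗[K] M →ₗ[K] M :=
  TensorProduct.lift (LinearMap.lsmul K M ∘ₗ permCoeff i)

lemma tensorCoeff_tmul {ι : Type} [Finite ι] [DecidableEq ι] (i : ι) {M : Type u}
    [AddCommGroup M] [Module K M] (p : (permOp K).obj.obj ι) (x : M) :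
    tensorCoeff i M (p ⊗ₜ x) = permCoeff i p • x := by
  simp [tensorCoeff]

/-- The decomposition of $\mathcal Perm(3)$ by coefficients tensors with $M$: every $z$ is $\sum_i
m_i\otimes z_i$, where $z_i$ is its $i$-th coefficient. -/
lemma eq_zero_of_tensorCoeff {M : Type u} [AddCommGroup M] [Module K M]
    (z : (permOp K).obj.obj (Fin 3) ⊗[K] M) (h : ∀ i, tensorCoeff i M z = 0) : z = 0 := by
  obtain ⟨m, hm⟩ := exists_sum_permCoeff_smul K
  suffices ∑ i, m i ⊗ₜ[K] tensorCoeff i M z = z by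
    rw [← this]
    simp [h]
  clear h
  induction z with
  | zero => simp
  | add x y hx hy => simp only [map_add, tmul_add, Finset.sum_add_distrib, hx, hy]
  | tmul p x =>
    conv_rhs => rw [← hm p, sum_tmul]
    simp only [tensorCoeff_tmul, tmul_smul, smul_tmul']

/-- Relabelling along `e` turns monomials starting with variable `i` into monomials starting with `e
i`, so the coefficients are permuted as well as relabelled. -/
lemma tensorCoeff_relabel (O : SymOperad K) {ι κ : Type} [Finite ι] [Finite κ] [DecidableEq ι]
    [DecidableEq κ] (e : ι ≃ κ) (i : ι) (z : (permOp K).obj.obj ι ⊗[K] O.obj ι) :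
    tensorCoeff (e i) _ (TensorProduct.map ((permOp K).obj.relabel e) (O.relabel e) z) =
      O.relabel e (tensorCoeff i _ z) := by
  induction z with
  | zero => simp
  | add x y hx hy => simp only [map_add, hx, hy]
  | tmul p q => simp [tensorCoeff_tmul, permCoeff_relabel]

/-- The isomorphism `O(2) × O(2) ≅ Perm(2) ⊗ O(2)` sending `(o, o')` to
`μ ⊗ o + μ^op ⊗ o'^op`. -/
def permTensor (O : SymOperad K) :
    (O.obj (Fin 2) × O.obj (Fin 2)) ≃ₗ[K] (permOp K).obj.obj (Fin 2) ⊗[K] O.obj (Fin 2) :=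
  LinearEquiv.ofLinearMap
    (LinearMap.coprod (TensorProduct.mk K _ _ (permGen (1, 0)))
      (TensorProduct.mk K _ _ (permGen (0, 1)) ∘ₗ O.swap))
    (LinearMap.prod (tensorCoeff 0 _) (O.swap ∘ₗ tensorCoeff 1 _))
    (by
      apply TensorProduct.ext'
      intro p q
      -- Every binary permutative operation is a combination of $\mu$ and $\mu^{op}$, so pure
      -- tensors can be split along these two.
      have hp : permCoeff 0 p • permGen (1, 0) + permCoeff 1 p • permGen (0, 1) = p := by
        rw [← map_smul, ← map_smul, ← map_add]
        conv_rhs => rw [← permGen_permCoeff p]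
        congr 1
        ext <;> simp
      conv_rhs => rw [← hp]
      simp [tensorCoeff_tmul, add_tmul, smul_tmul', O.swap_swap])
    (by
      apply LinearMap.ext
      rintro ⟨o, o'⟩
      simp [tensorCoeff_tmul, permCoeff_permGen, O.swap_swap])

lemma permTensor_apply (O : SymOperad K) (e : O.obj (Fin 2) × O.obj (Fin 2)) :
    permTensor O e = permGen (1, 0) ⊗ₜ e.1 + permGen (0, 1) ⊗ₜ O.swap e.2 := rfl

/-- This equivariance forces the swap in the second component of `permTensor`: the opposite of
$\mu\otimes o$ is $\mu^{op}\otimes o^{op}$. -/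
lemma permTensor_swap (O : SymOperad K) (e : O.obj (Fin 2) × O.obj (Fin 2)) :
    permTensor O e.swap = TensorProduct.map (permOp K).obj.swap O.swap (permTensor O e) := by
  simp [permTensor_apply, swap_permGen, O.swap_swap, add_comm]

lemma permTensor_natural {O O' : SymOperad K} (φ : SymOperad.Hom O O')
    (e : O.obj (Fin 2) × O.obj (Fin 2)) :
    permTensor O' (φ.app _ e.1, φ.app _ e.2) =
      TensorProduct.map LinearMap.id (φ.app (Fin 2)) (permTensor O e) := by
  simp [permTensor_apply, SymOperad.swap, φ.app_relabel]

/-- The ternary operation of `Perm ⊗ O` obtained by composing two binary operations. -/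
abbrev tensorComb (O : SymOperad K) (e f : O.obj (Fin 2) × O.obj (Fin 2)) :
    (permOp K).obj.obj (Fin 3) ⊗[K] O.obj (Fin 3) :=
  TensorProduct.map₂ (permOp K).obj.leftComb O.leftComb (permTensor O e) (permTensor O f)

lemma tensorCoeff_map₂ (O : SymOperad K) (i : Fin 3) (a b : K × K) (o o' : O.obj (Fin 2)) :
    tensorCoeff i _ (TensorProduct.map₂ (permOp K).obj.leftComb O.leftComb
      (permGen a ⊗ₜ o) (permGen b ⊗ₜ o')) =
      ![a.1 * b.1, a.1 * b.2, a.2 * (b.1 + b.2)] i • O.leftComb o o' := by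
  rw [← permCoeff_leftComb]
  exact tensorCoeff_tmul i _ _

/-- Bilinearity reduces this to the four composites of $\mu$ and $\mu^{op}$. These composites are
the formulas to be compared with iterated cup products. -/
lemma tensorCoeff_tensorComb (O : SymOperad K) (i : Fin 3) (e f : O.obj (Fin 2) × O.obj (Fin 2)) :
    tensorCoeff i _ (tensorComb O e f) =
      ![O.leftComb e.1 f.1, O.leftComb e.1 (O.swap f.2),
        O.leftComb (O.swap e.2) (f.1 + O.swap f.2)] i := by
  simp only [tensorComb, permTensor_apply, map_add, LinearMap.add_apply,
    tensorCoeff_map₂]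
  fin_cases i <;> simp

end PermTensor

/-! ### Binary operations and their composites on algebras. -/

namespace SymOperad.Alg

variable {K : Type u} [Field K] {O : SymOperad K} (A : O.Alg)

lemma act_leftComb (e f : O.obj (Fin 2)) (v : Fin 3 → A.V) :
    A.act (O.leftComb e f) v = A.prod e (A.prod f (v 0) (v 1)) (v 2) := by
  rw [prod_apply, prod_apply]
  refine (A.act_relabel _ _ _).trans ((A.act_comp _ _ _).trans ?_)
  congr 1
  funext i
  match i with
  | 0 =>
    change A.act f _ = A.act f _
    congr 1
    funext j
    fin_cases j <;> rfl
  | 1 => exact A.act_one _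

lemma prod_swap (e : O.obj (Fin 2)) (x y : A.V) : A.prod (O.swap e) x y = A.prod e y x := by
  rw [prod_apply, prod_apply, swap, A.act_relabel]
  congr 1
  funext j
  fin_cases j <;> rfl

end SymOperad.Alg

/-! ### Evaluation of relators on relative cochains. -/

section Evaluation

variable {K : Type u} [Field K] {O : SymOperad K} (A : O.Alg)

/-- The operations on the cochains with values in `A`. -/
def cochainOp : O.obj (Fin 2) × O.obj (Fin 2) →ₗ[K]
    Cochains K A.V →ₗ[K] Cochains K A.V →ₗ[K] Cochains K A.V :=
  (cochainAlg A).op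

lemma cochainOp_one (e : O.obj (Fin 2) × O.obj (Fin 2)) (x y : Cochains K A.V) :
    (cochainOp A e x y).1 {1} =
      A.prod e.1 (x.1 {1}) (y.1 {1}) + A.prod e.2 (y.1 {1}) (x.1 {1}) := by
  change (cup (A.prod e.1) x y).1 {1} + (cupOp (A.prod e.2) x y).1 {1} = _
  rw [cup_one, cupOp_one]

lemma cochainOp_edge (e : O.obj (Fin 2) × O.obj (Fin 2)) (x y : Cochains K A.V) :
    (cochainOp A e x y).1 {0, 1} =
      A.prod e.1 (x.1 {0, 1}) (y.1 {1}) + A.prod e.2 (y.1 {0, 1}) (x.1 {1}) := by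
  change (cup (A.prod e.1) x y).1 {0, 1} + (cupOp (A.prod e.2) x y).1 {0, 1} = _
  rw [cup_edge, cupOp_edge]

/-- At the right vertex every argument contributes through $t$, and $tt=t$; all permutative
monomials then evaluate alike and only the sum of the coefficients is visible. -/
lemma op_op_one (e f : O.obj (Fin 2) × O.obj (Fin 2)) (x : Fin 3 → Cochains K A.V) :
    (cochainOp A e (cochainOp A f (x 0) (x 1)) (x 2)).1 {1} =
      ∑ i, A.act (tensorCoeff i _ (tensorComb O e f)) (fun j => (x j).1 {1}) := by
  simp only [Fin.sum_univ_three, tensorCoeff_tensorComb, cochainOp_one]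
  simp [A.act_leftComb, A.prod_swap, add_assoc]

/-- On the edge the cup product takes the edge value of its left factor and the vertex value of its
right factor. After iteration, the edge value is taken from the first variable of each permutative
monomial. -/
lemma op_op_edge (e f : O.obj (Fin 2) × O.obj (Fin 2)) (x : Fin 3 → Cochains K A.V) :
    (cochainOp A e (cochainOp A f (x 0) (x 1)) (x 2)).1 {0, 1} =
      ∑ i, A.act (tensorCoeff i _ (tensorComb O e f))
        (Function.update (fun j => (x j).1 {1}) i ((x i).1 {0, 1})) := by
  simp only [Fin.sum_univ_three, tensorCoeff_tensorComb, cochainOp_one, cochainOp_edge]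
  simp [A.act_leftComb, A.prod_swap, add_assoc]

/-- The coefficients in `O(3)` of the value of a relator in `Perm(3) ⊗ O(3)`. -/
abbrev relCoeff (O : SymOperad K) (i : Fin 3)
    (r : (O.obj (Fin 2) × O.obj (Fin 2)) × (O.obj (Fin 2) × O.obj (Fin 2)) ×
      Equiv.Perm (Fin 3) →₀ K) : O.obj (Fin 3) :=
  tensorCoeff i _ (whiteEval (permOp K).obj O (relMap (permTensor O) r))

lemma relCoeff_eq (O : SymOperad K) (i : Fin 3)
    (r : (O.obj (Fin 2) × O.obj (Fin 2)) × (O.obj (Fin 2) × O.obj (Fin 2)) ×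
      Equiv.Perm (Fin 3) →₀ K) :
    relCoeff O i r = r.sum fun w c => c • tensorCoeff i _
      (TensorProduct.map ((permOp K).obj.relabel w.2.2) (O.relabel w.2.2)
        (tensorComb O w.1 w.2.1)) := by
  refine (congrArg (tensorCoeff i _) (linearCombination_relMap (permTensor O) _ r)).trans ?_
  simp only [Finsupp.linearCombination_apply, Finsupp.sum, map_sum, map_smul]

lemma quadEval_one (x : Fin 3 → Cochains K A.V)
    (r : (O.obj (Fin 2) × O.obj (Fin 2)) × (O.obj (Fin 2) × O.obj (Fin 2)) ×
      Equiv.Perm (Fin 3) →₀ K) :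
    (quadEval (fun e x y => cochainOp A e x y) x r).1 {1} =
      ∑ i, A.act (relCoeff O i r) (fun j => (x j).1 {1}) := by
  have key : ∀ w : (O.obj (Fin 2) × O.obj (Fin 2)) × (O.obj (Fin 2) × O.obj (Fin 2)) ×
      Equiv.Perm (Fin 3),
      (cochainOp A w.1 (cochainOp A w.2.1 (x (w.2.2 0)) (x (w.2.2 1)))
        (x (w.2.2 2))).1 {1} = ∑ i, A.act (tensorCoeff i _
      (TensorProduct.map ((permOp K).obj.relabel w.2.2) (O.relabel w.2.2)
        (tensorComb O w.1 w.2.1))) (fun j => (x j).1 {1}) := by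
    rintro ⟨e, f, σ⟩
    refine (op_op_one A e f (x ∘ σ)).trans ?_
    -- The $i$-th coefficient of the unpermuted composite is matched with the coefficient at `σ i`
    -- of the relabelled one.
    refine Fintype.sum_equiv σ _ _ fun i => ?_
    rw [tensorCoeff_relabel, A.act_relabel]
    rfl
  -- Evaluation at the vertex as a linear map, so that it passes through the sum over the relator.
  let ev : Cochains K A.V →ₗ[K] A.V :=
    LinearMap.proj ({1} : Finset (Fin 2)) ∘ₗ Submodule.subtype (relCochains K A.V {{0}})
  change ev (quadEval (fun e x y => cochainOp A e x y) x r) = _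
  simp only [relCoeff_eq, quadEval, Finsupp.linearCombination_apply, Finsupp.sum, map_sum,
    map_smul, sum_apply, smul_apply]
  rw [Finset.sum_comm]
  refine Finset.sum_congr rfl fun w _ => ?_
  rw [← Finset.smul_sum]
  exact congrArg _ (key w)

lemma quadEval_edge (x : Fin 3 → Cochains K A.V)
    (r : (O.obj (Fin 2) × O.obj (Fin 2)) × (O.obj (Fin 2) × O.obj (Fin 2)) ×
      Equiv.Perm (Fin 3) →₀ K) :
    (quadEval (fun e x y => cochainOp A e x y) x r).1 {0, 1} =
      ∑ i, A.act (relCoeff O i r)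
        (Function.update (fun j => (x j).1 {1}) i ((x i).1 {0, 1})) := by
  have key : ∀ w : (O.obj (Fin 2) × O.obj (Fin 2)) × (O.obj (Fin 2) × O.obj (Fin 2)) ×
      Equiv.Perm (Fin 3),
      (cochainOp A w.1 (cochainOp A w.2.1 (x (w.2.2 0)) (x (w.2.2 1)))
        (x (w.2.2 2))).1 {0, 1} = ∑ i, A.act (tensorCoeff i _
      (TensorProduct.map ((permOp K).obj.relabel w.2.2) (O.relabel w.2.2)
        (tensorComb O w.1 w.2.1))) (Function.update (fun j => (x j).1 {1}) i
          ((x i).1 {0, 1})) := by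
    rintro ⟨e, f, σ⟩
    refine (op_op_edge A e f (x ∘ σ)).trans ?_
    -- Here the position that receives the edge value moves along with the coefficient, from `i` to
    -- `σ i`.
    refine Fintype.sum_equiv σ _ _ fun i => ?_
    rw [tensorCoeff_relabel, A.act_relabel]
    congr 1
    funext j
    by_cases h : j = i
    · subst h; simp
    · simp [h]
  let ev : Cochains K A.V →ₗ[K] A.V :=
    LinearMap.proj ({0, 1} : Finset (Fin 2)) ∘ₗ Submodule.subtype (relCochains K A.V {{0}})
  change ev (quadEval (fun e x y => cochainOp A e x y) x r) = _
  simp only [relCoeff_eq, quadEval, Finsupp.linearCombination_apply, Finsupp.sum, map_sum,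
    map_smul, sum_apply, smul_apply]
  rw [Finset.sum_comm]
  refine Finset.sum_congr rfl fun w _ => ?_
  rw [← Finset.smul_sum]
  exact congrArg _ (key w)

/-- At most one argument has nonzero degree, so every exponent $n_in_j$ with $i\ne j$ is zero. -/
lemma koszulSign_eq_one (σ : Equiv.Perm (Fin 3)) (n : Fin 3 → ℕ) (h : n 0 + n 1 + n 2 ≤ 1) :
    koszulSign K σ n = 1 := by
  refine Finset.prod_eq_one fun a _ => Finset.prod_eq_one fun b _ => ?_
  split_ifs with hab
  · have hne : ∀ i j : Fin 3, j < i → n i * n j = 0 := by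
      intro i j hij
      rw [mul_eq_zero]
      fin_cases i <;> fin_cases j <;> simp at hij ⊢ <;> omega
    rw [hne _ _ hab.2, pow_zero]
  · rfl

lemma eq_zero_of_mem_cochainPiece {V : Type u} [AddCommGroup V] [Module K V] {n : ℕ}
    (hn : 2 ≤ n) {f : Cochains K V} (hf : f ∈ cochainPiece K V n) : f = 0 := by
  rw [mem_cochainPiece_iff] at hf
  exact cochain_ext (hf.1 (by omega)) (hf.2 (by omega))

/-- In total degree at least two each composite vanishes separately, because the 1-simplex has no
cochains there; below that, the signs are trivial. -/
lemma satisfies_iff_quadEval (r : (O.obj (Fin 2) × O.obj (Fin 2)) ×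
      (O.obj (Fin 2) × O.obj (Fin 2)) × Equiv.Perm (Fin 3) →₀ K) :
    (cochainAlg A).Satisfies r ↔ ∀ (n : Fin 3 → ℕ) (x : Fin 3 → Cochains K A.V),
      (∀ i, x i ∈ cochainPiece K A.V (n i)) → n 0 + n 1 + n 2 ≤ 1 →
        quadEval (fun e x y => cochainOp A e x y) x r = 0 := by
  refine forall₃_congr fun n x hx => ?_
  by_cases hn : n 0 + n 1 + n 2 ≤ 1
  · simp only [koszulSign_eq_one _ n hn, one_smul, hn, true_imp_iff]
    rfl
  · simp only [hn, false_imp_iff, iff_true]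
    change Finsupp.linearCombination K (fun w => koszulSign K w.2.2 n •
      cochainOp A w.1 (cochainOp A w.2.1 (x (w.2.2 0)) (x (w.2.2 1))) (x (w.2.2 2))) r = 0
    rw [Finsupp.linearCombination_apply]
    refine Finset.sum_eq_zero fun w _ => ?_
    -- Permuting the arguments does not change the total degree, so `op_mem` places every composite
    -- in this degree.
    have hw : n (w.2.2 0) + n (w.2.2 1) + n (w.2.2 2) = n 0 + n 1 + n 2 := by
      have := Equiv.sum_comp w.2.2 n
      simpa only [Fin.sum_univ_three] using this
    have h0 := (cochainAlg A).op_mem w.1 _ _ _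
      ((cochainAlg A).op_mem w.2.1 _ _ _ (hx (w.2.2 0)) _ (hx (w.2.2 1))) _ (hx (w.2.2 2))
    have h1 : cochainOp A w.1 (cochainOp A w.2.1 (x (w.2.2 0)) (x (w.2.2 1))) (x (w.2.2 2)) = 0 :=
      eq_zero_of_mem_cochainPiece (by omega) h0
    simp only [h1, smul_zero]

/-- Degree zero arguments detect only the sum of the three coefficients; it is the edge values that
separate them. -/
lemma satisfies_iff_act (r : (O.obj (Fin 2) × O.obj (Fin 2)) ×
      (O.obj (Fin 2) × O.obj (Fin 2)) × Equiv.Perm (Fin 3) →₀ K) :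
    (cochainAlg A).Satisfies r ↔ ∀ i, A.act (relCoeff O i r) = 0 := by
  rw [satisfies_iff_quadEval]
  constructor
  · intro h i
    ext v
    have he : (∅ : Finset (Fin 2)) ≠ {0, 1} := by decide
    have he1 : (∅ : Finset (Fin 2)) ≠ {1} := by decide
    have h0 : ({0} : Finset (Fin 2)) ≠ {0, 1} := by decide
    have h01 : ({0} : Finset (Fin 2)) ≠ {1} := by decide
    -- The test cochains are $v_i\,dt$ in position $i$ and $v_j\,t$ for $j\ne i$. On the edge they
    -- leave only the $i$-th coefficient, applied to $v$.
    let x : Fin 3 → Cochains K A.V := fun j =>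
      ⟨fun s => if j = i then (if s = {0, 1} then v j else 0) else (if s = {1} then v j else 0),
        cochain_mem_of (by rw [if_neg he, if_neg he1, ite_self])
          (by rw [if_neg h0, if_neg h01, ite_self])⟩
    have h10 : ({1} : Finset (Fin 2)) ≠ {0, 1} := by decide
    have hx1 : ∀ j, (x j).1 {1} = if j = i then 0 else v j := by
      intro j
      simp [x, h10]
    have hx01 : ∀ j, (x j).1 {0, 1} = if j = i then v j else 0 := by
      intro j
      simp [x, h10.symm]
    have hx : ∀ j, x j ∈ cochainPiece K A.V (if j = i then 1 else 0) := by
      intro j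
      rw [mem_cochainPiece_iff, hx1, hx01]
      by_cases j = i <;> simp [*]
    have h0 := congrArg (fun f => f.1 {0, 1}) (h _ x hx (by fin_cases i <;> simp))
    rw [quadEval_edge, Finset.sum_eq_single i] at h0
    · have hv : Function.update (fun j => (x j).1 {1}) i ((x i).1 {0, 1}) = v := by
        funext j
        by_cases hj : j = i
        · subst hj; simp [hx01]
        · simp [hj, hx1]
      rw [hv] at h0
      exact h0
    · intro k _ hk
      -- For $k\ne i$ the argument inserted in position $k$ is the edge value of $v_k\,t$, which is
      -- zero.
      refine (A.act _).map_coord_zero k ?_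
      simp [hx01, hk]
    · simp
  · intro h n x _ _
    apply cochain_ext
    · rw [quadEval_one]
      simp [h]
    · rw [quadEval_edge]
      simp [h]

end Evaluation

/-! ### Faithfulness on free algebras. -/

namespace QuadData

variable {K : Type u} [Field K]

/-- The free algebra of type `D`, as an algebra over the operad defined by `D`. -/
def freeOperadAlg (D : QuadData K) (κ : Type) : D.operad.Alg where
  V := D.FreeAlg κ
  act := D.multilinEval (D.op_isAlg κ)
  act_relabel e p v := D.lift_rename e (D.op_isAlg κ) v p.1
  act_one v := D.lift_var (D.op_isAlg κ) v ()
  act_comp p q v := by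
    refine (D.lift_lift (D.op_isAlg κ) _ _ _).trans ?_
    simp only [lift_rename]
    rfl

/-- Acting on the variables themselves, an operation `p` returns `p` as an element of the free
algebra. -/
lemma freeOperadAlg_act_injective (D : QuadData K) (κ : Type) [Finite κ] (p : D.operad.obj κ)
    (h : (D.freeOperadAlg κ).act p = 0) : p = 0 := by
  have h0 := congrArg (fun f => f (fun i => D.mon (.var i))) h
  exact Subtype.ext ((D.lift_self p.1).symm.trans h0)

end QuadData

/-- A binary quadratic operad acts faithfully on its algebras. -/
lemma Op.eq_zero_of_act {K : Type u} [Field K] (O : Op K) (κ : Type) [Finite κ]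
    (p : O.obj.obj κ) (h : ∀ A : O.obj.Alg, A.act p = 0) : p = 0 := by
  obtain ⟨D, -, ⟨φ⟩⟩ := O.property
  have h0 := D.freeOperadAlg_act_injective κ (SymOperad.Hom.app φ.hom κ p)
    (h ((D.freeOperadAlg κ).restrict φ.hom))
  rw [← SymOperad.id_app O.obj κ p, ← φ.hom_inv_id, SymOperad.comp_app, h0, map_zero]

/-! ### The natural isomorphism. -/

section Iso

variable {K : Type u} [Field K]

/-- The crux: relations valid in all cochain algebras are those whose coefficients act by zero on
every algebra. Faithfulness turns this into vanishing of the coefficients, hence of the value in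
$\mathcal Perm(3)\otimes\mathcal O(3)$. -/
lemma mem_permCircData_rel_iff (O : Op K) (r : (O.obj.obj (Fin 2) × O.obj.obj (Fin 2)) ×
      (O.obj.obj (Fin 2) × O.obj.obj (Fin 2)) × Equiv.Perm (Fin 3) →₀ K) :
    r ∈ (permCircData O.obj).rel ↔
      whiteEval (permOp K).obj O.obj (relMap (permTensor O.obj) r) = 0 := by
  refine (forall_congr' fun A => satisfies_iff_act A r).trans ⟨fun h => ?_, fun h A i => ?_⟩
  · exact eq_zero_of_tensorCoeff _ fun i => O.eq_zero_of_act _ _ fun A => h A i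
  · rw [relCoeff, h, map_zero, map_zero]

lemma relMap_relMap {E E' E'' : Type u} (g : E → E') (h : E' → E'')
    (r : E × E × Equiv.Perm (Fin 3) →₀ K) : relMap h (relMap g r) = relMap (h ∘ g) r := by
  simp [relMap, ← Finsupp.mapDomain_comp, Function.comp_def]

lemma relMap_id {E : Type u} (r : E × E × Equiv.Perm (Fin 3) →₀ K) : relMap id r = r :=
  Finsupp.mapDomain_id

/-- The quadratic data of `Perm_∘(O)` and of the white product of `Perm` and `O` are
isomorphic. -/
def permCircDataIso (O : Op K) : permCircData O.obj ≅ whiteData (permOp K).obj O.obj where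
  hom :=
    { map := (permTensor O.obj).toLinearMap
      map_swap := permTensor_swap O.obj
      map_rel := fun r hr => (mem_permCircData_rel_iff O r).1 hr }
  inv :=
    { map := (permTensor O.obj).symm.toLinearMap
      map_swap := fun e => by
        obtain ⟨e, rfl⟩ := (permTensor O.obj).surjective e
        refine (permTensor O.obj).injective ?_
        refine ((permTensor O.obj).apply_symm_apply _).trans ?_
        refine (permTensor_swap O.obj e).symm.trans ?_
        exact congrArg (fun e => permTensor O.obj (Prod.swap e))
          ((permTensor O.obj).symm_apply_apply e).symm
      map_rel := fun r hr => by
        refine (mem_permCircData_rel_iff O _).2 ?_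
        rw [relMap_relMap]
        have h : (⇑(permTensor O.obj) ∘ ⇑(permTensor O.obj).symm.toLinearMap) = id :=
          funext (permTensor O.obj).apply_symm_apply
        rw [h, relMap_id]
        exact hr }
  hom_inv_id := QuadData.Hom.ext (LinearMap.ext (permTensor O.obj).symm_apply_apply)
  inv_hom_id := QuadData.Hom.ext (LinearMap.ext (permTensor O.obj).apply_symm_apply)

/-- The natural isomorphism between `Perm_∘(-)` and the white product with `Perm`. -/
def permCircIso (K : Type u) [Field K] : permCirc K ≅ whiteProduct (permOp K) :=
  NatIso.ofComponents
    (fun O => ObjectProperty.isoMk _ ((QuadData.operadFunctor K).mapIso (permCircDataIso O)))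
    (fun {O O'} f => by
      apply ObjectProperty.hom_ext
      -- Both sides of the naturality square come from morphisms of quadratic data, so the square
      -- need only commute on generators.
      refine ((QuadData.operadFunctor K).map_comp (permCircMap f.hom)
        (permCircDataIso O').hom).symm.trans (Eq.trans ?_
        ((QuadData.operadFunctor K).map_comp (permCircDataIso O).hom
          (whiteMap (permOp K).obj f.hom)))
      exact congrArg _ (QuadData.Hom.ext (LinearMap.ext fun e => permTensor_natural f.hom e)))

/-- The isomorphism relabels the node of the generating monomial by `permTensor`, whose second
summand vanishes on `(o, 0)`. -/
lemma permCircIso_cupGen (O : Op K) (o : O.obj.obj (Fin 2)) :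
    SymOperad.Hom.app ((permCircIso K).hom.app O).hom (Fin 2) (cupGen O o) =
      whiteGen (permOp K) O (permMul K) o := by
  have h : permTensor O.obj (o, 0) = permMul K ⊗ₜ[K] o := by
    rw [permTensor_apply, map_zero, tmul_zero, add_zero]
    rfl
  refine Subtype.ext ?_
  refine (congrArg (QuadData.freeMap (permCircDataIso O).hom (Fin 2))
    ((permCircData O.obj).mon_node _ _ _)).trans ?_
  refine (QuadData.freeMap_op (permCircDataIso O).hom _ _ _).trans ?_
  rw [QuadData.freeMap_var, QuadData.freeMap_var, ← QuadData.mon_node]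
  exact congrArg (fun e => (whiteData (permOp K).obj O.obj).mon (.node e (.var 0) (.var 1))) h

end Iso
end ManinProduct

end

theorem theorem2p9 (K : Type u) [Field K] :
    ∃ η : permCirc K ≅ whiteProduct (permOp K),
      ∀ (O : Op K) (o : O.obj.obj (Fin 2)),
        SymOperad.Hom.app (η.hom.app O).hom (Fin 2) (cupGen O o) =
          whiteGen (permOp K) O (permMul K) o :=
  ⟨permCircIso K, permCircIso_cupGen⟩
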